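/- Let $L\ge 1$, let $m_0,\dots,m_L$ be layer widths, $k_1,\dots,k_L\ge 1$ filter widths, and let $\sigma:\mathbb R\to\mathbb R$ be Lipschitz continuous (applied to vectors componentwise). For an input $\mathbf x=(\mathbf x_1,\dots,\mathbf x_n)$ with $\mathbf x_t\in\mathbb R^{m_0}$, put $\mathbf x_t:=0$ for $t>n$, $\mathbf H^{(0)}_t:=\mathbf x_t$, and for $\ell=1,\dots,L$ and $t\ge 1$ $$\mathbf H^{(\ell)}_t := I^{(\ell)}\mathbf H^{(\ell-1)}_t+\sigma\Big(\mathbf b^{(\ell)}+\sum_{j=0}^{k_\ell-1}W^{(\ell)}_j\mathbf H^{(\ell-1)}_{t+j}\Big)\in\mathbb R^{m_\ell},$$ with arbitrary fixed $\mathbf b^{(\ell)}\in\mathbb R^{m_\ell}$ and $I^{(\ell)},W^{(\ell)}_j\in\mathbb R^{m_\ell\times m_{\ell-1}}$ (a fully convolutional network with residual connections). Let $\mathrm{GAP}(\mathbf x):=\frac1n\sum_{t=1}^n\mathbf H^{(L)}_t$ be its global average pooling output, let $K_L:=\sum_{q=1}^L k_q-(L-1)$, and let $\mathbf g_L=(g_1,\dots,g_{m_L}):(\mathbb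 R^{m_0})^{K_L}\to\mathbb R^{m_L}$ map a window $(u_1,\dots,u_{K_L})$ to the value $\mathbf H^{(L)}_1$ of the network on that window. Then $\mathbf g_L$ is Lipschitz, and $\mathbf H^{(L)}_t=\mathbf g_L(\mathbf x_t,\dots,\mathbf x_{t+K_L-1})$ for all $n$, all inputs $\mathbf x$ and all $t\ge1$. Let $(\mathbf X_t)_{t\ge1}$ be a linear process $\mathbf X_t=\sum_{j=0}^\infty A_j\mathbf Z_{t-j}$ in $\mathbb R^{m_0}$, where $(\mathbf Z_t)_{t\in\mathbb Z}$ is i.i.d. with $\mathbb E[\mathbf Z_0]=0$ and $\mathbb E\|\mathbf Z_0\|^2<\infty$, and the $m_0\times m_0$ matrices $A_j$ satisfy $\sum_{j\ge 0}\|A_j\|<\infty$. Write $\mathbf X=(\mathbf X_1,\dots,\mathbf X_n)$ and $g_j(\mathbf X_t)$ for $g_j(\mathbf X_t,\dots,\mathbf X_{t+K_L-1})$. Then all the expectations and covariances below exist, and, as $n\to\infty$, $$\sqrt n\,\big(\mathrm{GAP}(\mathbf X)-\mathbb E[\mathrm{GAP}(\mathbf X)]\big)\xrightarrow{\ \mathcal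 D\ }\mathcal N(\mathbf 0,\Sigma^{\mathrm{GAP}}),$$ where $\Sigma^{\mathrm{GAP}}$ is the long-run covariance matrix, with entries given by absolutely convergent series $$\Sigma^{\mathrm{GAP}}_{j,\ell}=\operatorname{Cov}\big(g_j(\mathbf X_1),g_\ell(\mathbf X_1)\big)+\sum_{h=1}^\infty\Big[\operatorname{Cov}\big(g_j(\mathbf X_1),g_\ell(\mathbf X_{1+h})\big)+\operatorname{Cov}\big(g_\ell(\mathbf X_1),g_j(\mathbf X_{1+h})\big)\Big],$$ and it is positive semidefinite. (If $\operatorname{Cov}(g_j(\mathbf X_1),g_\ell(\mathbf X_{1+h}))$ is symmetric in $j,\ell$, in particular for $j=\ell$, the sum is $2\sum_{h\ge1}\operatorname{Cov}(g_j(\mathbf X_1),g_\ell(\mathbf X_{1+h}))$.) -/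

import Mathlib

open MeasureTheory ProbabilityTheory Filter
open scoped NNReal Matrix

namespace FCN

/-- `ℝ^d` with the Euclidean norm. -/
abbrev Vec (d : ℕ) : Type := EuclideanSpace ℝ (Fin d)

/-- Parameters of a fully convolutional network with residual connections, with `L` layers,
layer widths `m 0` (the input dimension), `m 1, …, m L`, and filter widths `k`.
Layer number `i + 1` (for `i : Fin L`) maps `ℝ^(m i)`-valued sequences to `ℝ^(m (i+1))`-valued
ones; it has a bias, a residual connection matrix, and `k i` filters. -/
structure ResFCN (L : ℕ) (m : Fin (L + 1) → ℕ) (k : Fin L → ℕ) where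
  bias : (i : Fin L) → Vec (m i.succ)
  skip : (i : Fin L) → Matrix (Fin (m i.succ)) (Fin (m i.castSucc)) ℝ
  filter : (i : Fin L) → Fin (k i) → Matrix (Fin (m i.succ)) (Fin (m i.castSucc)) ℝ

/-- One convolutional layer with residual connection, applied to a sequence `h`: at time `t`,
`I h_t + σ (b + ∑_{j < k} W_j h_{t+j})`, with `σ` acting on each coordinate. -/
noncomputable def convLayer (σ : ℝ → ℝ) {p q k : ℕ} (b : Vec q) (I : Matrix (Fin q) (Fin p) ℝ)
    (W : Fin k → Matrix (Fin q) (Fin p) ℝ) (h : ℕ → Vec p) (t : ℕ) : Vec q :=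
  WithLp.toLp 2 fun r =>
    (I *ᵥ (h t).ofLp) r + σ (b r + ∑ j : Fin k, (W j *ᵥ (h (t + (j : ℕ))).ofLp) r)

/-- A finite input `x = (x_1, …, x_n)` as a sequence indexed by the times `1, 2, …`, extended by
zero for times `> n`. (The entry with index `0` is not a time and is never used.) -/
noncomputable def zeroPad {n d : ℕ} (x : Fin n → Vec d) (t : ℕ) : Vec d :=
  if h : 1 ≤ t ∧ t ≤ n then x ⟨t - 1, by omega⟩ else 0

namespace ResFCN

variable {L : ℕ} {m : Fin (L + 1) → ℕ} {k : Fin L → ℕ}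

/-- The activations `H^(ℓ)_t` of the layers `ℓ = 0, …, L` on a sequence `H^(0) = x`. -/
noncomputable def hidden (N : ResFCN L m k) (σ : ℝ → ℝ) (x : ℕ → Vec (m 0)) :
    (ℓ : Fin (L + 1)) → ℕ → Vec (m ℓ) :=
  Fin.induction x fun i h => convLayer σ (N.bias i) (N.skip i) (N.filter i) h

/-- The output series `H^(L)_t` on the zero-padded input `x_1, …, x_n`. -/
noncomputable def output (N : ResFCN L m k) (σ : ℝ → ℝ) {n : ℕ} (x : Fin n → Vec (m 0)) (t : ℕ) :
    Vec (m (Fin.last L)) :=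
  N.hidden σ (zeroPad x) (Fin.last L) t

/-- Global average pooling: `GAP(x) = n⁻¹ ∑_{t=1}^n H^(L)_t`. -/
noncomputable def gap (N : ResFCN L m k) (σ : ℝ → ℝ) {n : ℕ} (x : Fin n → Vec (m 0)) :
    Vec (m (Fin.last L)) :=
  (n : ℝ)⁻¹ • ∑ t ∈ Finset.Icc 1 n, N.output σ x t

/-- The window length `K_L = k_1 + ⋯ + k_L - (L - 1)`, written so that subtraction in `ℕ`
does not truncate when all filter widths are positive. -/
def windowLength (k : Fin L → ℕ) : ℕ := (∑ i, k i) + 1 - L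

/-- The window map `g_L` on windows of length `K_L`: the first output of the network on the
window. -/
noncomputable def windowMap (N : ResFCN L m k) (σ : ℝ → ℝ)
    (u : Fin (windowLength k) → Vec (m 0)) : Vec (m (Fin.last L)) :=
  N.output σ u 1

end ResFCN

/-- The window `(x_t, …, x_{t+K-1})`. -/
def window {E : Type*} (K : ℕ) (x : ℕ → E) (t : ℕ) : Fin K → E := fun i => x (t + (i : ℕ))

/-- `(X_t)_{t ≥ 1}` is the causal linear process `X_t = ∑_{j ≥ 0} A_j Z_{t-j}` (the series
converging almost surely) with i.i.d. centered square integrable innovations `(Z_t)_{t ∈ ℤ}` and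
`∑_j ‖A_j‖ < ∞` for the spectral norm. -/
structure IsLinearProcess {Ω : Type*} [MeasurableSpace Ω] (μ : Measure Ω) {d : ℕ}
    (A : ℕ → Matrix (Fin d) (Fin d) ℝ) (Z : ℤ → Ω → Vec d) (X : ℕ → Ω → Vec d) : Prop where
  measurable : ∀ t, Measurable (Z t)
  indep : iIndepFun Z μ
  identDistrib : ∀ t, IdentDistrib (Z t) (Z 0) μ μ
  memLp : MemLp (Z 0) 2 μ
  centered : ∫ ω, Z 0 ω ∂μ = 0
  summable : Summable fun j => ‖Matrix.toEuclideanCLM (𝕜 := ℝ) (n := Fin d) (A j)‖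
  eq_sum : ∀ t : ℕ, 1 ≤ t → ∀ᵐ ω ∂μ,
    HasSum (fun j : ℕ => Matrix.toEuclideanCLM (𝕜 := ℝ) (n := Fin d) (A j) (Z ((t : ℤ) - j) ω))
      (X t ω)

/-- The lag-`h` cross-covariance matrix `Γ(h)_{jℓ} = Cov(Y_{1,j}, Y_{1+h,ℓ})` of a series. -/
noncomputable def lagCov {Ω : Type*} [MeasurableSpace Ω] (μ : Measure Ω) {q : ℕ}
    (Y : ℕ → Ω → Vec q) (h : ℕ) : Matrix (Fin q) (Fin q) ℝ :=
  Matrix.of fun j l => cov[fun ω => Y 1 ω j, fun ω => Y (1 + h) ω l; μ]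

/-- The long-run covariance matrix `Γ(0) + ∑_{h ≥ 1} (Γ(h) + Γ(h)ᵀ)` of a series. -/
noncomputable def longRunCov {Ω : Type*} [MeasurableSpace Ω] (μ : Measure Ω) {q : ℕ}
    (Y : ℕ → Ω → Vec q) : Matrix (Fin q) (Fin q) ℝ :=
  Matrix.of fun j l =>
    lagCov μ Y 0 j l + ∑' h : ℕ, (lagCov μ Y (h + 1) j l + lagCov μ Y (h + 1) l j)

end FCN

/-! Each layer looks `k i - 1` steps ahead and is Lipschitz in what it sees, so the network is one
Lipschitz map of a sliding window (`hidden_last_eq_windowMap`, `exists_lipschitzWith_windowMap`).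
Pairing with a vector `θ` leaves a central limit theorem for sums of a real Lipschitz observable `f`
of windows of a linear process. It is proved with characteristic functions of centred variables, and
Lévy's continuity theorem then gives the vector statement.

No mixing is used. The substitute is a covariance inequality (`abs_covariance_pi_le`): if `u` and
`v` are Lipschitz with constants `c i`, `d i` in the `i`-th of finitely many i.i.d. variables, then
their covariance is at most `∑ c i * d i` times the second moment. The innovation at time `u` enters
a window starting at `t` with a weight summable in `t - u`, so the covariance at times `t` and `s`
is bounded by an autocorrelation `lagBound (t - s)` of a summable sequence, which is summable. The
bound is uniform over truncations to finitely many innovations and therefore survives `L²` limits.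
This gives absolute convergence of the long-run covariance series and convergence of `n⁻¹ Var` of
the sums to the long-run variance; positive semidefiniteness follows since variances are
nonnegative.

For the limit law (`exists_variance_sub_blockSum_le`) time is cut into blocks of length `p`, and
each window value is recomputed from the innovations of its own block, which makes the block sums
i.i.d. The error at position `s` of a block has covariances bounded both by a summable function of
the lag and by some `τ s → 0`. By dominated convergence the sum over lags of the smaller bound tends
to zero as `s` grows, and its Cesàro mean over the block is the error rate; windows crossing the
block end cost only `O(1/p)`. The i.i.d. theorem for fixed `p`, followed by large `p`, finishes the
proof (`tendsto_centeredChar_of_blocks`). Zero padding alters at most `K` windows, hence changes the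
sum by a bounded variance. -/

namespace ProbabilityTheory

/-! ### Standard deviation as a seminorm, and continuity of the covariance -/

section Covariance

variable {Ω : Type*} {mΩ : MeasurableSpace Ω} {μ : Measure Ω}

/-- Cauchy–Schwarz inequality for the covariance. -/
lemma abs_covariance_le_sqrt_variance [IsFiniteMeasure μ] {U V : Ω → ℝ} (hU : MemLp U 2 μ)
    (hV : MemLp V 2 μ) : |cov[U, V; μ]| ≤ √(Var[U; μ]) * √(Var[V; μ]) := by
  have h : ∀ x : ℝ, 0 ≤ Var[V; μ] * (x * x) + (2 * cov[U, V; μ]) * x + Var[U; μ] := by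
    intro x
    have h1 := variance_fun_add hU (hV.const_mul x)
    rw [variance_const_mul, covariance_const_mul_right] at h1
    have h2 := variance_nonneg (fun ω => U ω + x * V ω) μ
    linarith
  have h3 := discrim_le_zero h
  rw [discrim] at h3
  rw [← Real.sqrt_mul (variance_nonneg _ _)]
  apply Real.abs_le_sqrt
  linarith

/-- Minkowski's inequality for the seminorm `√Var`, in which all later approximations are measured;
it ignores constants, so means never have to be compared. -/
lemma sqrt_variance_add_le [IsFiniteMeasure μ] {U V : Ω → ℝ} (hU : MemLp U 2 μ)
    (hV : MemLp V 2 μ) :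
    √(Var[fun ω => U ω + V ω; μ]) ≤ √(Var[U; μ]) + √(Var[V; μ]) := by
  rw [variance_fun_add hU hV]
  apply Real.sqrt_le_iff.2 ⟨by positivity, ?_⟩
  have h1 := (abs_le.1 (abs_covariance_le_sqrt_variance hU hV)).2
  have h2 := Real.sq_sqrt (variance_nonneg U μ)
  have h3 := Real.sq_sqrt (variance_nonneg V μ)
  nlinarith

lemma sqrt_variance_le_add_sub [IsFiniteMeasure μ] {U V : Ω → ℝ} (hU : MemLp U 2 μ)
    (hV : MemLp V 2 μ) :
    √(Var[U; μ]) ≤ √(Var[V; μ]) + √(Var[fun ω => U ω - V ω; μ]) := by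
  have h := sqrt_variance_add_le hV (hU.sub hV)
  simp only [Pi.sub_apply, add_sub_cancel] at h
  exact h

lemma variance_sub_comm [IsFiniteMeasure μ] (U V : Ω → ℝ) :
    Var[fun ω => U ω - V ω; μ] = Var[fun ω => V ω - U ω; μ] := by
  rw [← variance_fun_neg]
  simp

lemma abs_sqrt_variance_sub_le [IsFiniteMeasure μ] {U V : Ω → ℝ} (hU : MemLp U 2 μ)
    (hV : MemLp V 2 μ) :
    |√(Var[U; μ]) - √(Var[V; μ])| ≤ √(Var[fun ω => U ω - V ω; μ]) := by
  have h1 := sqrt_variance_le_add_sub hU hV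
  have h2 := sqrt_variance_le_add_sub hV hU
  rw [variance_sub_comm] at h2
  rw [abs_le]
  constructor <;> linarith

lemma variance_add_le_two_mul [IsFiniteMeasure μ] {U V : Ω → ℝ} (hU : MemLp U 2 μ)
    (hV : MemLp V 2 μ) :
    Var[fun ω => U ω + V ω; μ] ≤ 2 * (Var[U; μ] + Var[V; μ]) := by
  have h := sqrt_variance_add_le hU hV
  have h2 := Real.sq_sqrt (variance_nonneg U μ)
  have h3 := Real.sq_sqrt (variance_nonneg V μ)
  have h4 := Real.sq_sqrt (variance_nonneg (fun ω => U ω + V ω) μ)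
  have h5 := Real.sqrt_nonneg (Var[fun ω => U ω + V ω; μ])
  nlinarith [sq_nonneg (√(Var[U; μ]) - √(Var[V; μ]))]

/-- The covariance is continuous for the convergence of variances of differences to zero. -/
lemma tendsto_covariance_of_tendsto_variance_sub [IsFiniteMeasure μ] {ι : Type*} {l : Filter ι}
    {U V : Ω → ℝ} {Un Vn : ι → Ω → ℝ} (hU : MemLp U 2 μ) (hV : MemLp V 2 μ)
    (hUn : ∀ n, MemLp (Un n) 2 μ) (hVn : ∀ n, MemLp (Vn n) 2 μ)
    (hUU : Tendsto (fun n => Var[fun ω => Un n ω - U ω; μ]) l (nhds 0))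
    (hVV : Tendsto (fun n => Var[fun ω => Vn n ω - V ω; μ]) l (nhds 0)) :
    Tendsto (fun n => cov[Un n, Vn n; μ]) l (nhds (cov[U, V; μ])) := by
  have hs : ∀ {v : ι → ℝ}, Tendsto v l (nhds 0) → Tendsto (fun n => √(v n)) l (nhds 0) :=
    fun h => by simpa using h.sqrt
  have key : Tendsto (fun n => √(Var[fun ω => Un n ω - U ω; μ]) * √(Var[fun ω => Vn n ω - V ω; μ])
      + √(Var[fun ω => Un n ω - U ω; μ]) * √(Var[V; μ])
      + √(Var[U; μ]) * √(Var[fun ω => Vn n ω - V ω; μ])) l (nhds 0) := by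
    have := (((hs hUU).mul (hs hVV)).add ((hs hUU).mul_const (√(Var[V; μ])))).add
      ((hs hVV).const_mul (√(Var[U; μ])))
    simpa using this
  rw [tendsto_iff_norm_sub_tendsto_zero]
  refine squeeze_zero (fun _ => norm_nonneg _) (fun n => ?_) key
  have e : cov[Un n, Vn n; μ] - cov[U, V; μ] =
      cov[fun ω => Un n ω - U ω, fun ω => Vn n ω - V ω; μ] + cov[fun ω => Un n ω - U ω, V; μ]
        + cov[U, fun ω => Vn n ω - V ω; μ] := by
    rw [covariance_fun_sub_fun_sub (hUn n) hU (hVn n) hV, covariance_fun_sub_left (hUn n) hU hV,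
      covariance_fun_sub_right hU (hVn n) hV]
    ring
  rw [e]
  refine (norm_add₃_le).trans ?_
  gcongr
  · exact abs_covariance_le_sqrt_variance ((hUn n).sub hU) ((hVn n).sub hV)
  · exact abs_covariance_le_sqrt_variance ((hUn n).sub hU) hV
  · exact abs_covariance_le_sqrt_variance hU ((hVn n).sub hV)

lemma sqrt_variance_le_of_eLpNorm_le [IsProbabilityMeasure μ] {U : Ω → ℝ} (hU : MemLp U 2 μ)
    {r : ℝ} (hr : 0 ≤ r) (h : eLpNorm U 2 μ ≤ ENNReal.ofReal r) : √(Var[U; μ]) ≤ r := by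
  apply Real.sqrt_le_iff.2 ⟨hr, ?_⟩
  refine (variance_le_expectation_sq hU.aestronglyMeasurable).trans ?_
  have h1 := hU.eLpNorm_eq_integral_rpow_norm (by norm_num) (by norm_num)
  rw [h1] at h
  have h0 : 0 ≤ ∫ ω, U ω ^ 2 ∂μ := integral_nonneg fun _ => sq_nonneg _
  have h2 := (ENNReal.ofReal_le_ofReal_iff hr).1 h
  simp only [ENNReal.toReal_ofNat, Real.rpow_ofNat, Real.norm_eq_abs, sq_abs] at h2
  rw [← one_div, ← Real.sqrt_eq_rpow] at h2
  simpa using (Real.sqrt_le_iff.1 h2).2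

end Covariance

/-! ### Covariance inequality for independent variables -/

section Product

variable {α β : Type*} {mα : MeasurableSpace α} {mβ : MeasurableSpace β}
  {ν : Measure α} {π : Measure β} [IsProbabilityMeasure ν] [IsProbabilityMeasure π]

/-- Law of total covariance on a product space. -/
lemma covariance_prod_eq {U V : α × β → ℝ} (hU : MemLp U 2 (ν.prod π)) (hV : MemLp V 2 (ν.prod π))
    (hU' : ∀ w, MemLp (fun z => U (z, w)) 2 ν) (hV' : ∀ w, MemLp (fun z => V (z, w)) 2 ν)
    (hUi : MemLp (fun w => ∫ z, U (z, w) ∂ν) 2 π) (hVi : MemLp (fun w => ∫ z, V (z, w) ∂ν) 2 π) :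
    cov[U, V; ν.prod π] = ∫ w, cov[fun z => U (z, w), fun z => V (z, w); ν] ∂π
      + cov[fun w => ∫ z, U (z, w) ∂ν, fun w => ∫ z, V (z, w) ∂ν; π] := by
  have hUV : Integrable (fun x => U x * V x) (ν.prod π) := hU.integrable_mul hV
  rw [covariance_eq_sub hU hV, covariance_eq_sub hUi hVi]
  have h1 : (∫ w, cov[fun z => U (z, w), fun z => V (z, w); ν] ∂π) =
      (∫ w, ∫ z, U (z, w) * V (z, w) ∂ν ∂π) -
        ∫ w, (∫ z, U (z, w) ∂ν) * (∫ z, V (z, w) ∂ν) ∂π := by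
    rw [← integral_sub hUV.integral_prod_right
      (show Integrable (fun w => (∫ z, U (z, w) ∂ν) * ∫ z, V (z, w) ∂ν) π from
        hUi.integrable_mul hVi)]
    congr 1 with w
    rw [covariance_eq_sub (hU' w) (hV' w)]
    rfl
  rw [h1, integral_prod_symm U (hU.integrable (by norm_num)),
    integral_prod_symm V (hV.integrable (by norm_num))]
  simp only [Pi.mul_apply]
  rw [integral_prod_symm _ hUV]
  ring

end Product

section CoordinatewiseLipschitz

variable {E : Type*} [NormedAddCommGroup E] [MeasurableSpace E] [BorelSpace E]
  [SecondCountableTopology E]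

lemma continuous_of_abs_sub_le_sum {E : Type*} [NormedAddCommGroup E] {ι : Type*} [Fintype ι] {u : (ι → E) → ℝ} {c : ι → ℝ}
    (hu : ∀ x y, |u x - u y| ≤ ∑ i, c i * ‖x i - y i‖) : Continuous u := by
  rw [continuous_iff_continuousAt]
  intro x
  rw [ContinuousAt, tendsto_iff_norm_sub_tendsto_zero]
  refine squeeze_zero (fun _ => norm_nonneg _) (fun y => hu y x) ?_
  have : Continuous fun y : ι → E => ∑ i, c i * ‖y i - x i‖ := by fun_prop
  simpa using this.tendsto x

lemma memLp_of_abs_sub_le_sum {Ω : Type*} {mΩ : MeasurableSpace Ω} {μ : Measure Ω}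
    [IsFiniteMeasure μ] {ι : Type*} [Fintype ι] {u : (ι → E) → ℝ} {c : ι → ℝ}
    (hu : ∀ x y, |u x - u y| ≤ ∑ i, c i * ‖x i - y i‖) {Z : ι → Ω → E}
    (hZ : ∀ i, MemLp (Z i) 2 μ) : MemLp (fun ω => u fun i => Z i ω) 2 μ := by
  have hs : MemLp (fun ω => ∑ i, c i * ‖Z i ω‖) 2 μ :=
    memLp_finsetSum Finset.univ fun i _ => (hZ i).norm.const_mul (c i)
  have hb : MemLp (fun ω => |u 0| + ∑ i, c i * ‖Z i ω‖) 2 μ := (memLp_const |u 0|).add hs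
  refine hb.mono' ?_ ?_
  · have h1 : AEMeasurable (fun ω i => Z i ω) μ :=
      aemeasurable_pi_lambda _ fun i => (hZ i).aestronglyMeasurable.aemeasurable
    have h2 : Measurable u := (continuous_of_abs_sub_le_sum hu).measurable
    exact (h2.comp_aemeasurable h1).aestronglyMeasurable
  · refine ae_of_all _ fun ω => ?_
    have := hu (fun i => Z i ω) 0
    simp only [Pi.zero_apply, sub_zero] at this
    calc ‖u fun i => Z i ω‖ = |u 0 + ((u fun i => Z i ω) - u 0)| := by simp
      _ ≤ _ := (abs_add_le _ _).trans (by gcongr)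

/-- The variance is at most the second moment about any point; the point `u 0` is chosen because `|u
z - u 0| ≤ c * ‖z‖`. -/
lemma variance_le_sq_mul_of_abs_sub_le {ν : Measure E} [IsProbabilityMeasure ν]
    (hν : MemLp id 2 ν) {u : E → ℝ} {c : ℝ} (hu : ∀ x y, |u x - u y| ≤ c * ‖x - y‖) :
    MemLp u 2 ν ∧ Var[u; ν] ≤ c ^ 2 * ∫ z, ‖z‖ ^ 2 ∂ν := by
  have hL : MemLp u 2 ν := memLp_of_abs_sub_le_sum (ι := Unit) (E := E) (u := fun x => u (x ()))
    (c := fun _ => c) (fun x y => by simpa using hu (x ()) (y ())) (Z := fun _ => id) fun _ => hν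
  refine ⟨hL, ?_⟩
  have h1 := variance_le_expectation_sq (hL.sub (memLp_const (u 0))).aestronglyMeasurable
  have h2 : Var[u; ν] = Var[u - fun _ => u 0; ν] :=
    (variance_sub_const hL.aestronglyMeasurable (u 0)).symm
  rw [h2, ← integral_const_mul]
  refine h1.trans (integral_mono (hL.sub (memLp_const (u 0))).integrable_sq
    (hν.norm.integrable_sq.const_mul _) fun z => ?_)
  have := hu z 0
  simp only [sub_zero] at this
  simp only [Pi.pow_apply, Pi.sub_apply]
  rw [← sq_abs, ← mul_pow]
  gcongr

lemma abs_covariance_le_mul_of_abs_sub_le {ν : Measure E} [IsProbabilityMeasure ν]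
    (hν : MemLp id 2 ν) {u v : E → ℝ} {c d : ℝ} (hc : 0 ≤ c) (hd : 0 ≤ d)
    (hu : ∀ x y, |u x - u y| ≤ c * ‖x - y‖) (hv : ∀ x y, |v x - v y| ≤ d * ‖x - y‖) :
    |cov[u, v; ν]| ≤ c * d * ∫ z, ‖z‖ ^ 2 ∂ν := by
  obtain ⟨hu1, hu2⟩ := variance_le_sq_mul_of_abs_sub_le hν hu
  obtain ⟨hv1, hv2⟩ := variance_le_sq_mul_of_abs_sub_le hν hv
  refine (abs_covariance_le_sqrt_variance hu1 hv1).trans ?_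
  have h0 : 0 ≤ ∫ z, ‖z‖ ^ 2 ∂ν := integral_nonneg fun _ => by positivity
  calc _ ≤ √(c ^ 2 * ∫ z, ‖z‖ ^ 2 ∂ν) * √(d ^ 2 * ∫ z, ‖z‖ ^ 2 ∂ν) := by gcongr
    _ = c * d * (√(∫ z, ‖z‖ ^ 2 ∂ν) * √(∫ z, ‖z‖ ^ 2 ∂ν)) := by
        rw [Real.sqrt_mul (sq_nonneg _), Real.sqrt_mul (sq_nonneg _), Real.sqrt_sq hc,
          Real.sqrt_sq hd]
        ring
    _ = _ := by rw [Real.mul_self_sqrt h0]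

/-- A covariance inequality of Efron–Stein type for coordinatewise Lipschitz functions of
independent variables. -/
theorem abs_covariance_pi_le {ν : Measure E} [IsProbabilityMeasure ν] (hν : MemLp id 2 ν) :
    ∀ {N : ℕ} {u v : (Fin N → E) → ℝ} {c d : Fin N → ℝ}, (∀ i, 0 ≤ c i) → (∀ i, 0 ≤ d i) →
      (∀ x y, |u x - u y| ≤ ∑ i, c i * ‖x i - y i‖) →
      (∀ x y, |v x - v y| ≤ ∑ i, d i * ‖x i - y i‖) →
      |cov[u, v; Measure.pi fun _ => ν]| ≤ (∑ i, c i * d i) * ∫ z, ‖z‖ ^ 2 ∂ν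
  | 0, u, v, c, d, _, _, hu, hv => by
    have : u = fun _ => u 0 := by ext x; rw [Subsingleton.elim x 0]
    rw [this]
    simp [covariance_const_left]
  | N + 1, u, v, c, d, hc, hd, hu, hv => by
    -- Condition on all coordinates but the first. The conditional covariance is the one-variable
    -- case and yields `c 0 * d 0`; the conditional means inherit the remaining Lipschitz constants
    -- (`hw`), so the induction hypothesis bounds their covariance.
    let e := (MeasurableEquiv.piFinSuccAbove (fun _ : Fin (N + 1) => E) 0).symm
    have he : MeasurePreserving e (ν.prod (Measure.pi fun _ => ν)) (Measure.pi fun _ => ν) :=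
      (measurePreserving_piFinSuccAbove (fun _ : Fin (N + 1) => ν) 0).symm
    have ee : ∀ z w, e (z, w) = Fin.cons z w := fun z w => by
      simp [e, MeasurableEquiv.piFinSuccAbove_symm_apply, Fin.insertNthEquiv]
    have hmem : ∀ {u : (Fin (N + 1) → E) → ℝ} {c : Fin (N + 1) → ℝ},
        (∀ x y, |u x - u y| ≤ ∑ i, c i * ‖x i - y i‖) →
        MemLp (u ∘ e) 2 (ν.prod (Measure.pi fun _ => ν)) := fun {u c} h => by
      have h1 : MemLp u 2 (Measure.pi fun _ => ν) := memLp_of_abs_sub_le_sum h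
        (Z := fun i (x : Fin (N + 1) → E) => x i) fun i => hν.comp_measurePreserving (measurePreserving_eval _ i)
      exact h1.comp_measurePreserving he
    have hz : ∀ {u : (Fin (N + 1) → E) → ℝ} {c : Fin (N + 1) → ℝ},
        (∀ x y, |u x - u y| ≤ ∑ i, c i * ‖x i - y i‖) → ∀ w (x y : E),
        |u (Fin.cons x w) - u (Fin.cons y w)| ≤ c 0 * ‖x - y‖ := fun h w x y => by
      simpa [Fin.sum_univ_succ] using h (Fin.cons x w) (Fin.cons y w)
    have hw : ∀ {u : (Fin (N + 1) → E) → ℝ} {c : Fin (N + 1) → ℝ},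
        (∀ x y, |u x - u y| ≤ ∑ i, c i * ‖x i - y i‖) → ∀ x y : Fin N → E,
        |(∫ z, u (Fin.cons z x) ∂ν) - ∫ z, u (Fin.cons z y) ∂ν| ≤
          ∑ i : Fin N, c i.succ * ‖x i - y i‖ := fun {u c} h x y => by
      have i1 : ∀ w, Integrable (fun z => u (Fin.cons z w)) ν := fun w =>
        (variance_le_sq_mul_of_abs_sub_le hν (hz h w)).1.integrable (by norm_num)
      rw [← integral_sub (i1 x) (i1 y), ← Real.norm_eq_abs]
      refine (norm_integral_le_of_norm_le_const (C := ∑ i : Fin N, c i.succ * ‖x i - y i‖)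
        (ae_of_all _ fun z => ?_)).trans_eq ?_
      · simpa [Fin.sum_univ_succ] using h (Fin.cons z x) (Fin.cons z y)
      · simp
    have hi : ∀ {u : (Fin (N + 1) → E) → ℝ} {c : Fin (N + 1) → ℝ},
        (∀ x y, |u x - u y| ≤ ∑ i, c i * ‖x i - y i‖) →
        MemLp (fun w : Fin N → E => ∫ z, (u ∘ e) (z, w) ∂ν) 2 (Measure.pi fun _ => ν) :=
      fun {u c} h => by
      simp only [Function.comp_apply, ee]
      exact memLp_of_abs_sub_le_sum (hw h)
        (Z := fun i (x : Fin N → E) => x i) fun i => hν.comp_measurePreserving (measurePreserving_eval _ i)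
    have hcov : cov[u, v; Measure.pi fun _ => ν] =
        cov[u ∘ e, v ∘ e; ν.prod (Measure.pi fun _ => ν)] := by
      rw [← he.map_eq, covariance_map_equiv]
    rw [hcov, covariance_prod_eq (hmem hu) (hmem hv) ?_ ?_ (hi hu) (hi hv)]
    · simp only [Function.comp_apply, ee]
      rw [Fin.sum_univ_succ, add_mul]
      refine (abs_add_le _ _).trans (add_le_add ?_ ?_)
      · rw [← Real.norm_eq_abs]
        refine (norm_integral_le_of_norm_le_const (C := c 0 * d 0 * ∫ z, ‖z‖ ^ 2 ∂ν)
          (ae_of_all _ fun w => ?_)).trans_eq ?_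
        · exact abs_covariance_le_mul_of_abs_sub_le hν (hc 0) (hd 0) (hz hu w) (hz hv w)
        · simp
      · exact abs_covariance_pi_le hν (fun i => hc _) (fun i => hd _) (hw hu) (hw hv)
    · intro w
      simp only [Function.comp_apply, ee]
      exact (variance_le_sq_mul_of_abs_sub_le hν (hz hu w)).1
    · intro w
      simp only [Function.comp_apply, ee]
      exact (variance_le_sq_mul_of_abs_sub_le hν (hz hv w)).1

end CoordinatewiseLipschitz

end ProbabilityTheory

/-! ### Lipschitz observables and i.i.d. noise indexed by the integers -/

namespace ProbabilityTheory

variable {Ω : Type*} {mΩ : MeasurableSpace Ω} {μ : Measure Ω}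

section Lipschitz

variable {E : Type*} [NormedAddCommGroup E]

/-- The sup distance is at most the sum of the coordinate distances; this puts a Lipschitz
observable into the coordinatewise form of the covariance inequality. -/
lemma _root_.LipschitzWith.abs_sub_le_mul_sum {ι : Type*} [Fintype ι] {f : (ι → E) → ℝ} {C : ℝ≥0}
    (hf : LipschitzWith C f) (x y : ι → E) : |f x - f y| ≤ C * ∑ i, ‖x i - y i‖ := by
  have h := hf.dist_le_mul x y
  rw [Real.dist_eq] at h
  refine h.trans ?_
  gcongr
  rw [dist_pi_le_iff (Finset.sum_nonneg fun _ _ => norm_nonneg _)]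
  intro i
  rw [dist_eq_norm]
  exact Finset.single_le_sum (f := fun i => ‖x i - y i‖) (fun _ _ => norm_nonneg _)
    (Finset.mem_univ i)

variable [MeasurableSpace E] [BorelSpace E] [SecondCountableTopology E] [IsProbabilityMeasure μ]

lemma _root_.LipschitzWith.memLp_comp_pi {K : ℕ} {f : (Fin K → E) → ℝ} {C : ℝ≥0}
    (hf : LipschitzWith C f) {X : Fin K → Ω → E} (hX : ∀ i, MemLp (X i) 2 μ) :
    MemLp (fun ω => f fun i => X i ω) 2 μ :=
  memLp_of_abs_sub_le_sum (c := fun _ => (C : ℝ))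
    (fun x y => by rw [← Finset.mul_sum]; exact hf.abs_sub_le_mul_sum x y) hX

/-- Turns `L²` errors of the window entries into an error in standard deviation of the observable.
-/
lemma _root_.LipschitzWith.sqrt_variance_comp_sub_le {K : ℕ} {f : (Fin K → E) → ℝ} {C : ℝ≥0}
    (hf : LipschitzWith C f) {X X' : Fin K → Ω → E} (hX : ∀ i, MemLp (X i) 2 μ)
    (hX' : ∀ i, MemLp (X' i) 2 μ) {r : Fin K → ℝ} (hr : ∀ i, 0 ≤ r i)
    (h : ∀ i, eLpNorm (fun ω => X i ω - X' i ω) 2 μ ≤ ENNReal.ofReal (r i)) :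
    √(Var[fun ω => f (fun i => X i ω) - f (fun i => X' i ω); μ]) ≤ C * ∑ i, r i := by
  have hr0 : 0 ≤ ∑ i, r i := Finset.sum_nonneg fun i _ => hr i
  refine sqrt_variance_le_of_eLpNorm_le ((hf.memLp_comp_pi hX).sub (hf.memLp_comp_pi hX'))
    (by positivity) ?_
  have h1 : eLpNorm (fun ω => f (fun i => X i ω) - f (fun i => X' i ω)) 2 μ ≤
      ENNReal.ofReal C * eLpNorm (fun ω => ∑ i, ‖X i ω - X' i ω‖) 2 μ := by
    refine eLpNorm_le_mul_eLpNorm_of_ae_le_mul (ae_of_all _ fun ω => ?_) 2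
    rw [Real.norm_eq_abs, Real.norm_of_nonneg (Finset.sum_nonneg fun _ _ => norm_nonneg _)]
    exact hf.abs_sub_le_mul_sum _ _
  refine h1.trans ?_
  rw [ENNReal.ofReal_mul (p := (C : ℝ)) C.2]
  gcongr
  have h2 : (fun ω => ∑ i, ‖X i ω - X' i ω‖) = ∑ i, fun ω => ‖X i ω - X' i ω‖ := by
    ext ω
    simp
  rw [h2, ENNReal.ofReal_sum_of_nonneg fun i _ => hr i]
  refine (eLpNorm_sum_le (fun i _ => ((hX i).sub (hX' i)).norm.aestronglyMeasurable)
    (by norm_num)).trans (Finset.sum_le_sum fun i _ => ?_)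
  rw [eLpNorm_norm]
  exact h i

end Lipschitz

/-- An i.i.d. sequence of square integrable random vectors indexed by `ℤ`. -/
structure IsIIDNoise {E : Type*} [NormedAddCommGroup E] [MeasurableSpace E] (μ : Measure Ω)
    (Z : ℤ → Ω → E) : Prop where
  measurable : ∀ t, Measurable (Z t)
  indep : iIndepFun Z μ
  identDistrib : ∀ t, IdentDistrib (Z t) (Z 0) μ μ
  memLp_zero : MemLp (Z 0) 2 μ

namespace IsIIDNoise

variable {E : Type*} [NormedAddCommGroup E] [MeasurableSpace E] [BorelSpace E] {Z : ℤ → Ω → E}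

lemma memLp (hZ : IsIIDNoise μ Z) (t : ℤ) : MemLp (Z t) 2 μ :=
  (hZ.identDistrib t).memLp_iff.2 hZ.memLp_zero

lemma shift (hZ : IsIIDNoise μ Z) (r : ℤ) : IsIIDNoise μ fun t => Z (t + r) where
  measurable _ := hZ.measurable _
  indep := hZ.indep.precomp (add_left_injective r)
  identDistrib _ := (hZ.identDistrib _).trans (hZ.identDistrib _).symm
  memLp_zero := hZ.memLp _

/-- By independence the law of the whole sequence is determined by the marginals, which a shift
preserves. All stationarity below comes from here. -/
lemma identDistrib_shift (hZ : IsIIDNoise μ Z) (r : ℤ) :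
    IdentDistrib (fun ω t => Z (t + r) ω) (fun ω t => Z t ω) μ μ :=
  IdentDistrib.pi (fun _ => (hZ.identDistrib _).trans (hZ.identDistrib _).symm)
    (hZ.shift r).indep hZ.indep

/-- Covariance inequality for functions of finitely many of the innovations that are
coordinatewise Lipschitz. -/
theorem abs_covariance_le [IsProbabilityMeasure μ] [SecondCountableTopology E] (hZ : IsIIDNoise μ Z) (J : Finset ℤ) {u v : (ℤ → E) → ℝ} {c d : ℤ → ℝ}
    (hc : ∀ s, 0 ≤ c s) (hd : ∀ s, 0 ≤ d s)
    (hu : ∀ x y, |u x - u y| ≤ ∑ s ∈ J, c s * ‖x s - y s‖)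
    (hv : ∀ x y, |v x - v y| ≤ ∑ s ∈ J, d s * ‖x s - y s‖) :
    |cov[fun ω => u fun s => Z s ω, fun ω => v fun s => Z s ω; μ]| ≤
      (∑ s ∈ J, c s * d s) * ∫ ω, ‖Z 0 ω‖ ^ 2 ∂μ := by
  let e := J.equivFin
  let ext : (Fin J.card → E) → ℤ → E := fun x s => if h : s ∈ J then x (e ⟨s, h⟩) else 0
  let ζ : Ω → Fin J.card → E := fun ω i => Z (e.symm i) ω
  have hνm : IsProbabilityMeasure (μ.map (Z 0)) :=
    Measure.isProbabilityMeasure_map (hZ.measurable 0).aemeasurable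
  have hζm : AEMeasurable ζ μ := aemeasurable_pi_lambda _ fun i => (hZ.measurable _).aemeasurable
  have hmap : μ.map ζ = Measure.pi fun _ => μ.map (Z 0) := by
    have h1 : iIndepFun (fun (i : Fin J.card) ω => Z (e.symm i) ω) μ :=
      hZ.indep.precomp (Subtype.val_injective.comp e.symm.injective)
    rw [(iIndepFun_iff_map_fun_eq_pi_map fun i => (hZ.measurable _).aemeasurable).1 h1]
    congr 1 with i : 1
    exact (hZ.identDistrib _).map_eq
  have hsum : ∀ (c : ℤ → ℝ) (g : ℤ → ℝ), ∑ s ∈ J, c s * g s =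
      ∑ i : Fin J.card, c (e.symm i) * g (e.symm i) := fun c g => by
    rw [← Finset.sum_coe_sort J, ← e.symm.sum_comp]
  have hlip : ∀ {u : (ℤ → E) → ℝ} {c : ℤ → ℝ},
      (∀ x y, |u x - u y| ≤ ∑ s ∈ J, c s * ‖x s - y s‖) → ∀ x y,
      |u (ext x) - u (ext y)| ≤ ∑ i : Fin J.card, c (e.symm i) * ‖x i - y i‖ :=
    fun {u c} h x y => by
      refine (h _ _).trans_eq ?_
      rw [hsum c fun s => ‖ext x s - ext y s‖]
      simp [ext]
  -- The Lipschitz bound involves only coordinates in `J`, so it forces `u` to ignore the others,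
  -- and they may be set to zero.
  have heq : ∀ {u : (ℤ → E) → ℝ} {c : ℤ → ℝ},
      (∀ x y, |u x - u y| ≤ ∑ s ∈ J, c s * ‖x s - y s‖) →
      (fun ω => u fun s => Z s ω) = fun ω => (u ∘ ext) (ζ ω) := fun {u c} h => by
    ext ω
    have h1 := h (fun s => Z s ω) (ext (ζ ω))
    have h2 : ∑ s ∈ J, c s * ‖Z s ω - ext (ζ ω) s‖ = 0 :=
      Finset.sum_eq_zero fun s hs => by simp [ext, hs, ζ]
    rw [h2] at h1
    exact sub_eq_zero.1 (abs_eq_zero.1 (le_antisymm h1 (abs_nonneg _)))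
  have hmeas : ∀ {u : (ℤ → E) → ℝ} {c : ℤ → ℝ},
      (∀ x y, |u x - u y| ≤ ∑ s ∈ J, c s * ‖x s - y s‖) →
      AEStronglyMeasurable (u ∘ ext) (μ.map ζ) := fun {u c} h =>
    (continuous_of_abs_sub_le_sum (hlip h)).measurable.aestronglyMeasurable
  rw [heq hu, heq hv, ← covariance_map_fun (hmeas hu) (hmeas hv) hζm, hmap, hsum c d]
  have hint : ∫ ω, ‖Z 0 ω‖ ^ 2 ∂μ = ∫ z, ‖z‖ ^ 2 ∂(μ.map (Z 0)) := by
    rw [integral_map (hZ.measurable 0).aemeasurable (by fun_prop)]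
  rw [hint]
  refine abs_covariance_pi_le ?_ (fun i => hc _) (fun i => hd _) (hlip hu) (hlip hv)
  rw [memLp_map_measure_iff (by fun_prop) (hZ.measurable 0).aemeasurable]
  exact hZ.memLp_zero

end IsIIDNoise

/-! ### Linear series with finitely many innovations -/

section Masked

variable {E : Type*} [NormedAddCommGroup E] [NormedSpace ℝ E]

/-- The linear series `∑_s a (t - s) z_s` with `s` restricted to a finite set `J`. -/
noncomputable def maskedSeries (a : ℤ → E →L[ℝ] E) (J : Finset ℤ) (z : ℤ → E) (t : ℤ) : E :=
  ∑ s ∈ J, a (t - s) (z s)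

/-- The window of length `K` of a masked linear series that starts at time `t`. -/
noncomputable def maskedWindow (K : ℕ) (a : ℤ → E →L[ℝ] E) (J : Finset ℤ) (z : ℤ → E) (t : ℤ) :
    Fin K → E :=
  fun κ => maskedSeries a J z (t + (κ : ℕ))

/-- The influence on a window that starts at time `0` of the innovation at time `-j`. -/
noncomputable def windowCoeff (K : ℕ) (a : ℤ → E →L[ℝ] E) (j : ℤ) : ℝ :=
  ∑ κ : Fin K, ‖a (j + (κ : ℕ))‖

/-- The autocorrelation of `windowCoeff`. -/
noncomputable def lagBound (K : ℕ) (a : ℤ → E →L[ℝ] E) (h : ℤ) : ℝ :=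
  ∑' u : ℤ, windowCoeff K a (u + h) * windowCoeff K a u

variable {K : ℕ} {a : ℤ → E →L[ℝ] E}

lemma windowCoeff_nonneg (j : ℤ) : 0 ≤ windowCoeff K a j :=
  Finset.sum_nonneg fun _ _ => norm_nonneg _

lemma lagBound_nonneg (h : ℤ) : 0 ≤ lagBound K a h :=
  tsum_nonneg fun _ => mul_nonneg (windowCoeff_nonneg _) (windowCoeff_nonneg _)

lemma summable_windowCoeff (ha : Summable fun j => ‖a j‖) : Summable (windowCoeff K a) :=
  summable_sum fun (κ : Fin K) _ =>
    (Equiv.addRight (((κ : ℕ) : ℤ))).summable_iff (f := fun j => ‖a j‖) |>.2 ha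

/-- The shear `(h, u) ↦ (u + h, u)` turns this into a product of two summable families. -/
lemma summable_windowCoeff_mul (ha : Summable fun j => ‖a j‖) :
    Summable fun p : ℤ × ℤ => windowCoeff K a (p.2 + p.1) * windowCoeff K a p.2 := by
  have h : Summable fun p : ℤ × ℤ => windowCoeff K a p.1 * windowCoeff K a p.2 :=
    (summable_windowCoeff (K := K) ha).mul_of_nonneg (summable_windowCoeff (K := K) ha)
      (fun j => windowCoeff_nonneg j) fun j => windowCoeff_nonneg j
  let e : ℤ × ℤ ≃ ℤ × ℤ :=
    { toFun := fun p => (p.2 + p.1, p.2)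
      invFun := fun p => (p.1 - p.2, p.2)
      left_inv := fun p => by simp
      right_inv := fun p => by simp }
  exact (e.summable_iff (f := fun p : ℤ × ℤ => windowCoeff K a p.1 * windowCoeff K a p.2)).2 h

lemma summable_lagBound (ha : Summable fun j => ‖a j‖) : Summable (lagBound K a) :=
  (summable_windowCoeff_mul ha).prod

/-- Substituting `u ↦ s - u` exhibits the sum as part of the autocorrelation series at lag `t - s`.
The bound no longer sees `J`, which allows limits over `J`. -/
lemma sum_windowCoeff_mul_le (ha : Summable fun j => ‖a j‖) (J : Finset ℤ) (t s : ℤ) :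
    ∑ u ∈ J, windowCoeff K a (t - u) * windowCoeff K a (s - u) ≤ lagBound K a (t - s) := by
  have h1 : Summable fun u : ℤ => windowCoeff K a (u + (t - s)) * windowCoeff K a u :=
    (summable_windowCoeff_mul ha).prod_factor (t - s)
  have h2 : (fun u : ℤ => windowCoeff K a (t - u) * windowCoeff K a (s - u)) =
      (fun u : ℤ => windowCoeff K a (u + (t - s)) * windowCoeff K a u) ∘ Equiv.subLeft s := by
    ext u
    simp only [Function.comp_apply, Equiv.subLeft_apply]
    congr 2
    ring
  rw [lagBound, ← (Equiv.subLeft s).tsum_eq]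
  have h3 := (Equiv.subLeft s).summable_iff.2 h1
  rw [← h2] at h3
  have h4 := h3.sum_le_tsum J fun _ _ =>
    mul_nonneg (windowCoeff_nonneg _) (windowCoeff_nonneg _)
  refine h4.trans_eq (congrArg tsum h2)

/-- The innovation at time `s` acts on all `K` entries of the window, and `windowCoeff` adds up
these influences. The larger set `J'` lets two observables with different masks share one index set.
-/
lemma abs_comp_maskedWindow_sub_le {f : (Fin K → E) → ℝ} {C : ℝ≥0} (hf : LipschitzWith C f)
    {J J' : Finset ℤ} (hJ : J ⊆ J') (t : ℤ) (x y : ℤ → E) :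
    |f (maskedWindow K a J x t) - f (maskedWindow K a J y t)| ≤
      ∑ s ∈ J', C * windowCoeff K a (t - s) * ‖x s - y s‖ := by
  refine (hf.abs_sub_le_mul_sum _ _).trans ?_
  calc (C : ℝ) * ∑ κ : Fin K, ‖maskedWindow K a J x t κ - maskedWindow K a J y t κ‖
      ≤ C * ∑ κ : Fin K, ∑ s ∈ J, ‖a (t - s + (κ : ℕ))‖ * ‖x s - y s‖ := by
        gcongr with κ
        simp only [maskedWindow, maskedSeries]
        rw [← Finset.sum_sub_distrib]
        refine norm_sum_le_of_le _ fun s _ => ?_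
        rw [← map_sub, show t + (κ : ℕ) - s = t - s + (κ : ℕ) by ring]
        exact (a _).le_opNorm _
    _ = ∑ s ∈ J, C * windowCoeff K a (t - s) * ‖x s - y s‖ := by
        rw [Finset.sum_comm, Finset.mul_sum]
        simp only [windowCoeff, Finset.sum_mul, Finset.mul_sum, mul_assoc]
    _ ≤ _ := Finset.sum_le_sum_of_subset_of_nonneg hJ fun s _ _ => by
        have := windowCoeff_nonneg (K := K) (a := a) (t - s)
        positivity

lemma continuous_maskedSeries (J : Finset ℤ) (t : ℤ) :
    Continuous fun z : ℤ → E => maskedSeries a J z t := by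
  unfold maskedSeries
  fun_prop

lemma continuous_maskedWindow (J : Finset ℤ) (t : ℤ) :
    Continuous fun z : ℤ → E => maskedWindow K a J z t :=
  continuous_pi fun _ => continuous_maskedSeries _ _

lemma maskedSeries_shift (J : Finset ℤ) (z : ℤ → E) (t r : ℤ) :
    maskedSeries a (J.map (addRightEmbedding r)) z (t + r) =
      maskedSeries a J (fun s => z (s + r)) t := by
  simp [maskedSeries]

lemma maskedWindow_shift (J : Finset ℤ) (z : ℤ → E) (t r : ℤ) :
    maskedWindow K a (J.map (addRightEmbedding r)) z (t + r) =
      maskedWindow K a J (fun s => z (s + r)) t := by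
  ext κ
  simp only [maskedWindow]
  rw [← maskedSeries_shift, add_right_comm]

/-- The total weight of the innovations outside `J` in the linear series at time `t`. -/
noncomputable def maskTail (a : ℤ → E →L[ℝ] E) (J : Finset ℤ) (t : ℤ) : ℝ :=
  ∑' s : ℤ, if s ∈ J then 0 else ‖a (t - s)‖

lemma maskTail_nonneg (J : Finset ℤ) (t : ℤ) : 0 ≤ maskTail a J t :=
  tsum_nonneg fun s => by split_ifs <;> positivity

lemma summable_maskTail (ha : Summable fun j => ‖a j‖) (J : Finset ℤ) (t : ℤ) :
    Summable fun s : ℤ => if s ∈ J then 0 else ‖a (t - s)‖ :=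
  have h : Summable fun s : ℤ => ‖a (t - s)‖ :=
    ((Equiv.subLeft t).summable_iff (f := fun j => ‖a j‖)).2 ha
  h.of_nonneg_of_le (fun s => by split_ifs <;> positivity) fun s => by split_ifs <;> simp

lemma maskTail_le (ha : Summable fun j => ‖a j‖) (J : Finset ℤ) (t : ℤ) :
    maskTail a J t ≤ ∑' j, ‖a j‖ := by
  rw [← (Equiv.subLeft t).tsum_eq fun j => ‖a j‖]
  have h : Summable fun s : ℤ => ‖a (t - s)‖ :=
    ((Equiv.subLeft t).summable_iff (f := fun j => ‖a j‖)).2 ha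
  refine (summable_maskTail ha J t).tsum_le_tsum (fun s => ?_) h
  split_ifs <;> simp

end Masked

/-! ### From finitely many innovations to `L²` limits -/

section LinearSeries

variable {E : Type*} [NormedAddCommGroup E] [NormedSpace ℝ E] [MeasurableSpace E] [BorelSpace E]
  [SecondCountableTopology E] [IsProbabilityMeasure μ] {K : ℕ} {a : ℤ → E →L[ℝ] E}
  {Z : ℤ → Ω → E}

omit [SecondCountableTopology E] [IsProbabilityMeasure μ] in
lemma IsIIDNoise.memLp_maskedSeries (hZ : IsIIDNoise μ Z) (J : Finset ℤ) (t : ℤ) :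
    MemLp (fun ω => maskedSeries a J (fun s => Z s ω) t) 2 μ :=
  memLp_finsetSum J fun s _ => (a (t - s)).comp_memLp' (hZ.memLp s)

lemma IsIIDNoise.memLp_comp_maskedWindow (hZ : IsIIDNoise μ Z) {f : (Fin K → E) → ℝ} {C : ℝ≥0}
    (hf : LipschitzWith C f) (J : Finset ℤ) (t : ℤ) :
    MemLp (fun ω => f (maskedWindow K a J (fun s => Z s ω) t)) 2 μ :=
  hf.memLp_comp_pi fun κ : Fin K => hZ.memLp_maskedSeries J (t + (κ : ℕ))

lemma IsIIDNoise.abs_covariance_maskedWindow_le (hZ : IsIIDNoise μ Z)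
    (ha : Summable fun j => ‖a j‖) {f g : (Fin K → E) → ℝ} {C D : ℝ≥0}
    (hf : LipschitzWith C f) (hg : LipschitzWith D g) (J J' : Finset ℤ) (t s : ℤ) :
    |cov[fun ω => f (maskedWindow K a J (fun s => Z s ω) t),
        fun ω => g (maskedWindow K a J' (fun s => Z s ω) s); μ]| ≤
      C * D * (∫ ω, ‖Z 0 ω‖ ^ 2 ∂μ) * lagBound K a (t - s) := by
  have h := hZ.abs_covariance_le (J ∪ J') (u := fun z => f (maskedWindow K a J z t))
    (v := fun z => g (maskedWindow K a J' z s)) (c := fun u => C * windowCoeff K a (t - u))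
    (d := fun u => D * windowCoeff K a (s - u))
    (fun u => mul_nonneg C.2 (windowCoeff_nonneg _))
    (fun u => mul_nonneg D.2 (windowCoeff_nonneg _))
    (abs_comp_maskedWindow_sub_le hf Finset.subset_union_left t)
    (abs_comp_maskedWindow_sub_le hg Finset.subset_union_right s)
  refine h.trans ?_
  have h0 : 0 ≤ ∫ ω, ‖Z 0 ω‖ ^ 2 ∂μ := integral_nonneg fun _ => by positivity
  have h1 := sum_windowCoeff_mul_le (K := K) ha (J ∪ J') t s
  calc _ = C * D * (∫ ω, ‖Z 0 ω‖ ^ 2 ∂μ) *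
        ∑ u ∈ J ∪ J', windowCoeff K a (t - u) * windowCoeff K a (s - u) := by
        rw [mul_right_comm, Finset.mul_sum]
        congr 1
        exact Finset.sum_congr rfl fun _ _ => by ring
    _ ≤ _ := by gcongr

/-- `U` is square integrable and a limit in variance of values of the observable `f` on windows
at time `t` of masked series. -/
def IsMaskedLimit (μ : Measure Ω) (a : ℤ → E →L[ℝ] E) (Z : ℤ → Ω → E) (f : (Fin K → E) → ℝ)
    (t : ℤ) (U : Ω → ℝ) : Prop :=
  MemLp U 2 μ ∧ ∃ J : ℕ → Finset ℤ, Tendsto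
    (fun n => Var[fun ω => f (maskedWindow K a (J n) (fun s => Z s ω) t) - U ω; μ]) atTop (nhds 0)

lemma IsIIDNoise.isMaskedLimit (hZ : IsIIDNoise μ Z) {f : (Fin K → E) → ℝ} {C : ℝ≥0}
    (hf : LipschitzWith C f) (J : Finset ℤ) (t : ℤ) :
    IsMaskedLimit μ a Z f t fun ω => f (maskedWindow K a J (fun s => Z s ω) t) :=
  ⟨hZ.memLp_comp_maskedWindow hf J t, fun _ => J, by
    simp only [sub_self]
    have : Var[fun _ : Ω => (0 : ℝ); μ] = 0 := variance_zero μ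
    simp [this]⟩

lemma IsMaskedLimit.abs_covariance_le (hZ : IsIIDNoise μ Z)
    (ha : Summable fun j => ‖a j‖) {f g : (Fin K → E) → ℝ} {C D : ℝ≥0}
    (hf : LipschitzWith C f) (hg : LipschitzWith D g) {t s : ℤ} {U V : Ω → ℝ}
    (hU : IsMaskedLimit μ a Z f t U) (hV : IsMaskedLimit μ a Z g s V) :
    |cov[U, V; μ]| ≤ C * D * (∫ ω, ‖Z 0 ω‖ ^ 2 ∂μ) * lagBound K a (t - s) := by
  obtain ⟨hU2, J, hJ⟩ := hU
  obtain ⟨hV2, J', hJ'⟩ := hV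
  exact le_of_tendsto (tendsto_covariance_of_tendsto_variance_sub hU2 hV2
    (fun n => hZ.memLp_comp_maskedWindow hf (J n) t)
    (fun n => hZ.memLp_comp_maskedWindow hg (J' n) s) hJ hJ').abs
    (Eventually.of_forall fun n => hZ.abs_covariance_maskedWindow_le ha hf hg _ _ _ _)

/-- Intended for block errors, where a window value and its truncation are both masked limits at the
same time; the factor 4 counts the covariances in the bilinear expansion. -/
lemma IsMaskedLimit.abs_covariance_sub_le (hZ : IsIIDNoise μ Z)
    (ha : Summable fun j => ‖a j‖) {f : (Fin K → E) → ℝ} {C : ℝ≥0}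
    (hf : LipschitzWith C f) {t s : ℤ} {U U' V V' : Ω → ℝ}
    (hU : IsMaskedLimit μ a Z f t U) (hU' : IsMaskedLimit μ a Z f t U')
    (hV : IsMaskedLimit μ a Z f s V) (hV' : IsMaskedLimit μ a Z f s V') :
    |cov[fun ω => U ω - U' ω, fun ω => V ω - V' ω; μ]| ≤
      4 * (C * C * (∫ ω, ‖Z 0 ω‖ ^ 2 ∂μ) * lagBound K a (t - s)) := by
  rw [covariance_fun_sub_fun_sub hU.1 hU'.1 hV.1 hV'.1]
  have h1 := abs_le.1 (hU.abs_covariance_le hZ ha hf hf hV)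
  have h2 := abs_le.1 (hU.abs_covariance_le hZ ha hf hf hV')
  have h3 := abs_le.1 (hU'.abs_covariance_le hZ ha hf hf hV)
  have h4 := abs_le.1 (hU'.abs_covariance_le hZ ha hf hf hV')
  rw [abs_le]
  constructor <;> linarith [h1.1, h1.2, h2.1, h2.2, h3.1, h3.2, h4.1, h4.2]

omit [SecondCountableTopology E] [IsProbabilityMeasure μ] in
lemma IsIIDNoise.eLpNorm_maskedSeries_le (hZ : IsIIDNoise μ Z) (J : Finset ℤ) (t : ℤ) :
    eLpNorm (fun ω => maskedSeries a J (fun s => Z s ω) t) 2 μ ≤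
      ENNReal.ofReal ((∑ s ∈ J, ‖a (t - s)‖) * (eLpNorm (Z 0) 2 μ).toReal) := by
  have h1 : (fun ω => maskedSeries a J (fun s => Z s ω) t) =
      ∑ s ∈ J, fun ω => a (t - s) (Z s ω) := by
    ext ω
    simp [maskedSeries]
  rw [h1]
  refine (eLpNorm_sum_le (fun s _ => ((a (t - s)).comp_memLp' (hZ.memLp s)).aestronglyMeasurable)
    (by norm_num)).trans ?_
  rw [Finset.sum_mul, ENNReal.ofReal_sum_of_nonneg fun _ _ => by positivity]
  refine Finset.sum_le_sum fun s _ => ?_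
  rw [ENNReal.ofReal_mul (norm_nonneg _), ENNReal.ofReal_toReal hZ.memLp_zero.2.ne,
    ← (hZ.identDistrib s).eLpNorm_eq]
  exact eLpNorm_le_mul_eLpNorm_of_ae_le_mul (ae_of_all _ fun ω => (a (t - s)).le_opNorm _) 2

omit [SecondCountableTopology E] [IsProbabilityMeasure μ] in
/-- The error in `L²` of a masked series. -/
lemma IsIIDNoise.eLpNorm_sub_maskedSeries_le (hZ : IsIIDNoise μ Z) (ha : Summable fun j => ‖a j‖)
    {t : ℤ} {X : Ω → E} (hX : ∀ᵐ ω ∂μ, HasSum (fun s : ℤ => a (t - s) (Z s ω)) (X ω))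
    (J : Finset ℤ) :
    eLpNorm (fun ω => X ω - maskedSeries a J (fun s => Z s ω) t) 2 μ ≤
      ENNReal.ofReal (maskTail a J t * (eLpNorm (Z 0) 2 μ).toReal) := by
  have hlim : Tendsto (fun n : ℕ => J ∪ Finset.Icc (-(n : ℤ)) n) atTop atTop := by
    refine tendsto_atTop_finset_of_monotone ?_ ?_
    · intro m n hmn
      refine Finset.union_subset_union_right (Finset.Icc_subset_Icc ?_ ?_) <;> simpa using hmn
    · intro x
      refine ⟨x.natAbs, ?_⟩
      simp only [Finset.mem_union, Finset.mem_Icc]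
      right
      omega
  have hdiff : ∀ (n : ℕ) (z : ℤ → E),
      maskedSeries a (J ∪ Finset.Icc (-(n : ℤ)) n) z t - maskedSeries a J z t =
        maskedSeries a ((J ∪ Finset.Icc (-(n : ℤ)) n) \ J) z t := fun n z => by
    simp only [maskedSeries]
    rw [sub_eq_iff_eq_add, Finset.sum_sdiff Finset.subset_union_left]
  -- Fatou's lemma along exhausting sets that contain `J`: the differences are then masked series
  -- over indices outside `J`.
  refine (Lp.eLpNorm_lim_le_liminf_eLpNorm (f := fun (n : ℕ) ω =>
    maskedSeries a ((J ∪ Finset.Icc (-(n : ℤ)) n) \ J) (fun s => Z s ω) t)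
    (fun n => (hZ.memLp_maskedSeries _ t).aestronglyMeasurable) _ ?_).trans ?_
  · filter_upwards [hX] with ω hω
    simp only [← hdiff]
    exact (Tendsto.comp hω hlim).sub_const _
  · refine liminf_le_of_le (by isBoundedDefault) fun b hb => ?_
    obtain ⟨n, hn⟩ := hb.exists
    refine hn.trans ((hZ.eLpNorm_maskedSeries_le _ t).trans (ENNReal.ofReal_le_ofReal ?_))
    gcongr
    refine le_trans (le_of_eq ?_)
      ((summable_maskTail ha J t).sum_le_tsum ((J ∪ Finset.Icc (-(n : ℤ)) n) \ J)
        fun s _ => by split_ifs <;> positivity)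
    refine Finset.sum_congr rfl fun s hs => ?_
    rw [if_neg (Finset.mem_sdiff.1 hs).2]

omit [SecondCountableTopology E] [IsProbabilityMeasure μ] in
lemma IsIIDNoise.memLp_of_hasSum (hZ : IsIIDNoise μ Z) (ha : Summable fun j => ‖a j‖)
    {t : ℤ} {X : Ω → E} (hX : ∀ᵐ ω ∂μ, HasSum (fun s : ℤ => a (t - s) (Z s ω)) (X ω)) :
    MemLp X 2 μ := by
  refine ⟨?_, ?_⟩
  · refine aestronglyMeasurable_of_tendsto_ae (atTop : Filter (Finset ℤ))
      (f := fun J ω => maskedSeries a J (fun s => Z s ω) t)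
      (fun J => (hZ.memLp_maskedSeries J t).aestronglyMeasurable) ?_
    filter_upwards [hX] with ω hω using hω
  -- With the empty mask the truncation error is `X` itself.
  · have h := hZ.eLpNorm_sub_maskedSeries_le ha hX ∅
    simp only [maskedSeries, Finset.sum_empty, sub_zero] at h
    exact h.trans_lt ENNReal.ofReal_lt_top

end LinearSeries

end ProbabilityTheory

/-! ### Grouping independent variables, and variances of sums -/

namespace ProbabilityTheory

variable {Ω : Type*} {mΩ : MeasurableSpace Ω} {μ : Measure Ω}

lemma _root_.Finset.sum_range_mul_eq {M : Type*} [AddCommMonoid M] (F : ℕ → M) (q p : ℕ) :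
    ∑ t ∈ Finset.range (q * p), F t =
      ∑ b ∈ Finset.range q, ∑ s ∈ Finset.range p, F (b * p + s) := by
  induction q with
  | zero => simp
  | succ q ih => rw [add_mul, one_mul, Finset.sum_range_add, ih, Finset.sum_range_succ]

/-- Grouping the variables of an independent family indexed by a product gives an independent
family of processes. -/
lemma iIndepFun.curry {ι κ F : Type*} [MeasurableSpace F] {X : ι × κ → Ω → F}
    (mX : ∀ p, Measurable (X p)) (h : iIndepFun X μ) :
    iIndepFun (fun i ω j => X (i, j) ω) μ := by
  have := h.isProbabilityMeasure
  have hp : ∀ i j, IsProbabilityMeasure (μ.map (X (i, j))) := fun i j =>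
    Measure.isProbabilityMeasure_map (mX _).aemeasurable
  rw [iIndepFun_iff_map_fun_eq_infinitePi_map fun i => measurable_pi_lambda _ fun j => mX (i, j)]
  have h1 := (iIndepFun_iff_map_fun_eq_infinitePi_map mX).1 h
  have h2 : (fun ω i j => X (i, j) ω) = MeasurableEquiv.curry ι κ F ∘ fun ω p => X p ω := rfl
  rw [h2, ← Measure.map_map (MeasurableEquiv.measurable _) (measurable_pi_lambda _ mX), h1]
  have h3 := Measure.infinitePi_map_curry fun i j => μ.map (X (i, j))
  simp only [Prod.mk.eta] at h3
  rw [h3]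
  congr 1 with i : 1
  exact ((iIndepFun_iff_map_fun_eq_infinitePi_map fun j => mX (i, j)).1
    (h.precomp (g := fun j => (i, j)) fun j j' hj => (Prod.mk.inj hj).2)).symm

/-- If the covariances of a stationary series are summable, then the variances of its partial sums
grow linearly, with the long-run variance as rate. -/
lemma tendsto_variance_sum_div [IsFiniteMeasure μ] {Y : ℕ → Ω → ℝ} (hY : ∀ t, MemLp (Y t) 2 μ)
    (hst : ∀ t h, cov[Y t, Y (t + h); μ] = cov[Y 0, Y h; μ])
    (hsum : Summable fun h => cov[Y 0, Y (h + 1); μ]) :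
    Tendsto (fun n : ℕ => (n : ℝ)⁻¹ * Var[fun ω => ∑ t ∈ Finset.range n, Y t ω; μ]) atTop
      (nhds (cov[Y 0, Y 0; μ] + ∑' h, 2 * cov[Y 0, Y (h + 1); μ])) := by
  have hS : ∀ n, MemLp (fun ω => ∑ t ∈ Finset.range n, Y t ω) 2 μ := fun n =>
    memLp_finsetSum _ fun t _ => hY t
  -- The variance increments are the partial sums of the long-run variance series, so `n⁻¹ Var` is a
  -- Cesàro mean of these partial sums.
  have hstep : ∀ n, Var[fun ω => ∑ t ∈ Finset.range (n + 1), Y t ω; μ] =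
      Var[fun ω => ∑ t ∈ Finset.range n, Y t ω; μ] +
        (cov[Y 0, Y 0; μ] + ∑ h ∈ Finset.range n, 2 * cov[Y 0, Y (h + 1); μ]) := fun n => by
    simp only [Finset.sum_range_succ]
    rw [variance_fun_add (hS n) (hY n), covariance_fun_sum_left' (fun t _ => hY t) (hY n),
      ← covariance_self (hY n).aestronglyMeasurable.aemeasurable]
    have h1 : ∑ t ∈ Finset.range n, cov[Y t, Y n; μ] =
        ∑ h ∈ Finset.range n, cov[Y 0, Y (h + 1); μ] := by
      rw [← Finset.sum_range_reflect]
      refine Finset.sum_congr rfl fun t ht => ?_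
      have ht := Finset.mem_range.1 ht
      rw [← hst (n - 1 - t) (t + 1)]
      congr 2
      omega
    have h2 : cov[Y n, Y n; μ] = cov[Y 0, Y 0; μ] := hst n 0
    rw [h1, h2, Finset.mul_sum]
    ring
  have hvar : ∀ n, Var[fun ω => ∑ t ∈ Finset.range n, Y t ω; μ] = ∑ i ∈ Finset.range n,
      (cov[Y 0, Y 0; μ] + ∑ h ∈ Finset.range i, 2 * cov[Y 0, Y (h + 1); μ]) := fun n => by
    induction n with
    | zero =>
      simp only [Finset.range_zero, Finset.sum_empty]
      exact variance_zero μ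
    | succ n ih => rw [hstep, ih, Finset.sum_range_succ]
  simp only [hvar]
  exact ((hsum.mul_left 2).hasSum.tendsto_sum_nat.const_add _).cesaro

/-- The variance of a sum is bounded by sums of bounds of the covariances. -/
lemma variance_sum_le_sum_tsum [IsFiniteMeasure μ] {D : ℕ → Ω → ℝ} (I : Finset ℕ)
    (hD : ∀ t ∈ I, MemLp (D t) 2 μ) {q : ℕ → ℤ → ℝ} (hq0 : ∀ t h, 0 ≤ q t h)
    (hq : ∀ t, Summable (q t)) (hcov : ∀ t ∈ I, ∀ s ∈ I, |cov[D t, D s; μ]| ≤ q t (t - s)) :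
    Var[fun ω => ∑ t ∈ I, D t ω; μ] ≤ ∑ t ∈ I, ∑' h, q t h := by
  rw [variance_fun_sum' hD]
  refine Finset.sum_le_sum fun t ht => ?_
  have hinj : Function.Injective fun s : ℕ => (t : ℤ) - s := fun s s' h => by
    simp only at h
    omega
  calc ∑ s ∈ I, cov[D t, D s; μ] ≤ ∑ s ∈ I, q t (t - s) :=
        Finset.sum_le_sum fun s hs => (le_abs_self _).trans (hcov t ht s hs)
    _ ≤ ∑' s : ℕ, q t (t - s) :=
        ((hq t).comp_injective hinj).sum_le_tsum I fun _ _ => hq0 _ _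
    _ ≤ ∑' h, q t h :=
        tsum_comp_le_tsum_of_inj (hq t) (hq0 t) hinj

end ProbabilityTheory

/-! ### Truncation tails and stationarity of window observables -/

namespace ProbabilityTheory

variable {Ω : Type*} {mΩ : MeasurableSpace Ω} {μ : Measure Ω}

section Tail

variable {E : Type*} [NormedAddCommGroup E] [NormedSpace ℝ E] {a : ℤ → E →L[ℝ] E}

lemma tendsto_maskTail (ha : Summable fun j => ‖a j‖) {ι : Type*} {l : Filter ι}
    {J : ι → Finset ℤ} (hJ : ∀ s, ∀ᶠ n in l, s ∈ J n) (t : ℤ) :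
    Tendsto (fun n => maskTail a (J n) t) l (nhds 0) := by
  have h : Summable fun s : ℤ => ‖a (t - s)‖ :=
    ((Equiv.subLeft t).summable_iff (f := fun j => ‖a j‖)).2 ha
  have h2 := tendsto_tsum_of_dominated_convergence (𝓕 := l)
    (f := fun n s => if s ∈ J n then 0 else ‖a (t - s)‖) (g := fun _ => (0 : ℝ)) h
    (fun s => tendsto_const_nhds.congr' ((hJ s).mono fun n hn => by simp [hn]))
    (Eventually.of_forall fun n s => by split_ifs <;> simp)
  rw [tsum_zero] at h2
  exact h2

/-- The total weight of the lags larger than `s`. -/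
noncomputable def lagTail (a : ℤ → E →L[ℝ] E) (s : ℕ) : ℝ :=
  ∑' j : ℤ, if j ≤ s then 0 else ‖a j‖

lemma summable_lagTail (ha : Summable fun j => ‖a j‖) (s : ℕ) :
    Summable fun j : ℤ => if j ≤ s then 0 else ‖a j‖ :=
  ha.of_nonneg_of_le (fun j => by split_ifs <;> positivity) fun j => by split_ifs <;> simp

lemma lagTail_nonneg (s : ℕ) : 0 ≤ lagTail a s :=
  tsum_nonneg fun j => by split_ifs <;> positivity

lemma tendsto_lagTail (ha : Summable fun j => ‖a j‖) :
    Tendsto (lagTail a) atTop (nhds 0) := by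
  have h2 := tendsto_tsum_of_dominated_convergence (𝓕 := atTop)
    (f := fun (s : ℕ) (j : ℤ) => if j ≤ s then 0 else ‖a j‖) (g := fun _ => (0 : ℝ)) ha
    (fun j => tendsto_const_nhds.congr' ((eventually_ge_atTop j.natAbs).mono fun n hn => by
      have h : j ≤ n := by omega
      simp [h]))
    (Eventually.of_forall fun n s => by split_ifs <;> simp)
  rw [tsum_zero] at h2
  exact h2

/-- A time missing from `J` is either after `t`, where causality makes the coefficient vanish, or
more than `s` steps in the past. -/
lemma maskTail_le_lagTail (ha : Summable fun j => ‖a j‖) (ha0 : ∀ j < 0, a j = 0) {J : Finset ℤ}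
    {t : ℤ} {s : ℕ} (hJ : ∀ u, t - s ≤ u → u ≤ t → u ∈ J) : maskTail a J t ≤ lagTail a s := by
  have h1 := ((Equiv.subLeft t).summable_iff
    (f := fun j : ℤ => if j ≤ s then 0 else ‖a j‖)).2 (summable_lagTail ha s)
  rw [lagTail, ← (Equiv.subLeft t).tsum_eq]
  refine (summable_maskTail ha J t).tsum_le_tsum (fun u => ?_) h1
  simp only [Equiv.subLeft_apply]
  by_cases hu : u ∈ J
  · rw [if_pos hu]
    split_ifs <;> positivity
  · rw [if_neg hu]
    by_cases h2 : t - u ≤ s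
    · have h3 : t < u := by
        by_contra h4
        exact hu (hJ u (by omega) (by omega))
      rw [ha0 _ (by omega)]
      simp [h2]
    · rw [if_neg h2]

end Tail

section Series

variable {E : Type*} [NormedAddCommGroup E] [NormedSpace ℝ E] [MeasurableSpace E] [BorelSpace E]
  [SecondCountableTopology E] [IsProbabilityMeasure μ] {K : ℕ} {a : ℤ → E →L[ℝ] E}
  {Z : ℤ → Ω → E} {X : ℕ → Ω → E}

/-- `X_t = ∑_s a (t - s) Z_s` almost surely, for all times `t : ℕ`. -/
def IsLinearSeries (μ : Measure Ω) (a : ℤ → E →L[ℝ] E) (Z : ℤ → Ω → E) (X : ℕ → Ω → E) : Prop :=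
  ∀ t : ℕ, ∀ᵐ ω ∂μ, HasSum (fun s : ℤ => a (t - s) (Z s ω)) (X t ω)

namespace IsLinearSeries

lemma memLp (hX : IsLinearSeries μ a Z X) (hZ : IsIIDNoise μ Z) (ha : Summable fun j => ‖a j‖)
    (t : ℕ) : MemLp (X t) 2 μ :=
  hZ.memLp_of_hasSum ha (hX t)

lemma memLp_window (hX : IsLinearSeries μ a Z X) (hZ : IsIIDNoise μ Z)
    (ha : Summable fun j => ‖a j‖) {f : (Fin K → E) → ℝ} {C : ℝ≥0} (hf : LipschitzWith C f)
    (t : ℕ) : MemLp (fun ω => f fun κ => X (t + κ) ω) 2 μ :=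
  hf.memLp_comp_pi (X := fun (κ : Fin K) => X (t + κ)) fun _ => hX.memLp hZ ha _

lemma sqrt_variance_sub_masked_le (hX : IsLinearSeries μ a Z X) (hZ : IsIIDNoise μ Z)
    (ha : Summable fun j => ‖a j‖) {f : (Fin K → E) → ℝ} {C : ℝ≥0} (hf : LipschitzWith C f)
    (t : ℕ) (J : Finset ℤ) :
    √(Var[fun ω => (f fun κ => X (t + κ) ω) - f (maskedWindow K a J (fun s => Z s ω) t); μ]) ≤
      C * ∑ κ : Fin K, maskTail a J (t + (κ : ℕ)) * (eLpNorm (Z 0) 2 μ).toReal :=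
  hf.sqrt_variance_comp_sub_le (X := fun (κ : Fin K) => X (t + κ))
    (X' := fun (κ : Fin K) ω => maskedSeries a J (fun s => Z s ω) (t + (κ : ℕ)))
    (r := fun κ : Fin K => maskTail a J (t + (κ : ℕ)) * (eLpNorm (Z 0) 2 μ).toReal)
    (fun κ => hX.memLp hZ ha _) (fun κ => hZ.memLp_maskedSeries J _)
    (fun κ => mul_nonneg (maskTail_nonneg _ _) ENNReal.toReal_nonneg)
    fun κ => hZ.eLpNorm_sub_maskedSeries_le ha (by exact_mod_cast hX (t + κ)) J

lemma tendsto_variance_masked_sub (hX : IsLinearSeries μ a Z X) (hZ : IsIIDNoise μ Z)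
    (ha : Summable fun j => ‖a j‖) {f : (Fin K → E) → ℝ} {C : ℝ≥0} (hf : LipschitzWith C f)
    (t : ℕ) {J : ℕ → Finset ℤ} (hJ : ∀ s, ∀ᶠ n in atTop, s ∈ J n) :
    Tendsto (fun n => Var[fun ω => f (maskedWindow K a (J n) (fun s => Z s ω) t) -
      f fun κ => X (t + κ) ω; μ]) atTop (nhds 0) := by
  have h1 : Tendsto (fun n => (C * ∑ κ : Fin K, maskTail a (J n) (t + (κ : ℕ)) *
      (eLpNorm (Z 0) 2 μ).toReal) ^ 2) atTop (nhds 0) := by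
    have h2 : Tendsto (fun n => ∑ κ : Fin K, maskTail a (J n) (t + (κ : ℕ)) *
        (eLpNorm (Z 0) 2 μ).toReal) atTop
        (nhds (∑ κ : Fin K, 0 * (eLpNorm (Z 0) 2 μ).toReal)) :=
      tendsto_finsetSum _ fun κ _ => (tendsto_maskTail ha hJ _).mul_const _
    simpa using (h2.const_mul (C : ℝ)).pow 2
  refine squeeze_zero (fun _ => variance_nonneg _ _) (fun n => ?_) h1
  rw [variance_sub_comm]
  have h3 := hX.sqrt_variance_sub_masked_le hZ ha hf t (J n)
  exact (Real.sqrt_le_iff.1 h3).2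

lemma eventually_mem_Icc (s : ℤ) : ∀ᶠ n : ℕ in atTop, s ∈ Finset.Icc (-(n : ℤ)) n :=
  (eventually_ge_atTop s.natAbs).mono fun n hn => by
    rw [Finset.mem_Icc]
    omega

lemma isMaskedLimit (hX : IsLinearSeries μ a Z X) (hZ : IsIIDNoise μ Z)
    (ha : Summable fun j => ‖a j‖) {f : (Fin K → E) → ℝ} {C : ℝ≥0} (hf : LipschitzWith C f)
    (t : ℕ) : IsMaskedLimit μ a Z f t fun ω => f fun κ => X (t + κ) ω :=
  ⟨hX.memLp_window hZ ha hf t, _, hX.tendsto_variance_masked_sub hZ ha hf t eventually_mem_Icc⟩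

/-- Truncating the left side with masks shifted by `r` makes the two covariances equal for every
`n`, because the joint law of the noise is shift invariant. Shifted masks still exhaust `ℤ`, so the
limits agree. -/
lemma covariance_window_shift (hX : IsLinearSeries μ a Z X) (hZ : IsIIDNoise μ Z)
    (ha : Summable fun j => ‖a j‖) {f g : (Fin K → E) → ℝ} {C D : ℝ≥0} (hf : LipschitzWith C f)
    (hg : LipschitzWith D g) (t s r : ℕ) :
    cov[fun ω => f fun κ => X (t + r + κ) ω, fun ω => g fun κ => X (s + r + κ) ω; μ] =
      cov[fun ω => f fun κ => X (t + κ) ω, fun ω => g fun κ => X (s + κ) ω; μ] := by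
  let J : ℕ → Finset ℤ := fun n => Finset.Icc (-(n : ℤ)) n
  have hJ' : ∀ s, ∀ᶠ n in atTop, s ∈ (J n).map (addRightEmbedding (r : ℤ)) := fun s =>
    (eventually_mem_Icc (s - r)).mono fun n hn =>
      Finset.mem_map.2 ⟨s - r, hn, by simp [addRightEmbedding]⟩
  have h1 := tendsto_covariance_of_tendsto_variance_sub (hX.memLp_window hZ ha hf (t + r))
    (hX.memLp_window hZ ha hg (s + r))
    (fun n => hZ.memLp_comp_maskedWindow hf _ _) (fun n => hZ.memLp_comp_maskedWindow hg _ _)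
    (hX.tendsto_variance_masked_sub hZ ha hf (t + r) hJ')
    (hX.tendsto_variance_masked_sub hZ ha hg (s + r) hJ')
  have h2 := tendsto_covariance_of_tendsto_variance_sub (hX.memLp_window hZ ha hf t)
    (hX.memLp_window hZ ha hg s)
    (fun n => hZ.memLp_comp_maskedWindow hf _ _) (fun n => hZ.memLp_comp_maskedWindow hg _ _)
    (hX.tendsto_variance_masked_sub hZ ha hf t eventually_mem_Icc)
    (hX.tendsto_variance_masked_sub hZ ha hg s eventually_mem_Icc)
  refine tendsto_nhds_unique (h1.congr fun n => ?_) h2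
  simp only [Nat.cast_add, maskedWindow_shift]
  have hid := hZ.identDistrib_shift (r : ℤ)
  have hu : Measurable fun z : ℤ → E => f (maskedWindow K a (J n) z t) :=
    (hf.continuous.comp (continuous_maskedWindow _ _)).measurable
  have hv : Measurable fun z : ℤ → E => g (maskedWindow K a (J n) z s) :=
    (hg.continuous.comp (continuous_maskedWindow _ _)).measurable
  have h3 := covariance_map_fun hu.aestronglyMeasurable hv.aestronglyMeasurable
    hid.aemeasurable_fst
  have h4 := covariance_map_fun hu.aestronglyMeasurable hv.aestronglyMeasurable
    hid.aemeasurable_snd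
  rw [← h3, ← h4, hid.map_eq]

/-- Cross-covariances of Lipschitz observables of a linear process are summable over the lags. -/
lemma summable_covariance_window (hX : IsLinearSeries μ a Z X) (hZ : IsIIDNoise μ Z)
    (ha : Summable fun j => ‖a j‖) {f g : (Fin K → E) → ℝ} {C D : ℝ≥0} (hf : LipschitzWith C f)
    (hg : LipschitzWith D g) :
    Summable fun h : ℕ => cov[fun ω => f fun κ => X (0 + κ) ω,
      fun ω => g fun κ => X (h + 1 + κ) ω; μ] := by
  have hinj : Function.Injective fun h : ℕ => ((0 : ℕ) : ℤ) - ((h + 1 : ℕ) : ℤ) :=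
    fun h h' hh => by
      simp only at hh
      omega
  refine .of_norm_bounded (((summable_lagBound (K := K) ha).comp_injective hinj).mul_left
    (C * D * (∫ ω, ‖Z 0 ω‖ ^ 2 ∂μ))) fun h => ?_
  exact (hX.isMaskedLimit hZ ha hf 0).abs_covariance_le hZ ha hf hg
    (hX.isMaskedLimit hZ ha hg (h + 1))

end IsLinearSeries

/-! ### Block approximation -/

/-- The `b`-th block of `p` consecutive times. -/
noncomputable def timeBlock (p b : ℕ) : Finset ℤ := Finset.Ico ((b * p : ℕ) : ℤ) ((b * p + p : ℕ) : ℤ)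

/-- The sum of an observable over the `b`-th block of `p` windows, computed from the innovations
of that block only. -/
noncomputable def blockSum (a : ℤ → E →L[ℝ] E) (Z : ℤ → Ω → E) (f : (Fin K → E) → ℝ) (p b : ℕ)
    (ω : Ω) : ℝ :=
  ∑ s ∈ Finset.range p,
    f (maskedWindow K a (timeBlock p b) (fun u => Z u ω) ((b * p + s : ℕ) : ℤ))

lemma timeBlock_eq_map (p b : ℕ) :
    timeBlock p b = (timeBlock p 0).map (addRightEmbedding ((b * p : ℕ) : ℤ)) := by
  ext x
  simp only [timeBlock, Finset.mem_map, Finset.mem_Ico, addRightEmbedding_apply]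
  constructor
  · intro h
    exact ⟨x - (b * p : ℕ), by omega, by omega⟩
  · rintro ⟨y, hy, rfl⟩
    omega

omit [MeasurableSpace E] [BorelSpace E] [SecondCountableTopology E] in
lemma blockSum_eq_shift (f : (Fin K → E) → ℝ) (p b : ℕ) (ω : Ω) :
    blockSum a Z f p b ω = ∑ s ∈ Finset.range p,
      f (maskedWindow K a (timeBlock p 0) (fun u => Z (u + (b * p : ℕ)) ω) s) := by
  refine Finset.sum_congr rfl fun s _ => ?_
  rw [← maskedWindow_shift (timeBlock p 0) (fun u => Z u ω) s ((b * p : ℕ) : ℤ),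
    ← timeBlock_eq_map, Nat.cast_add, add_comm]

namespace IsIIDNoise

lemma memLp_blockSum (hZ : IsIIDNoise μ Z) {f : (Fin K → E) → ℝ} {C : ℝ≥0}
    (hf : LipschitzWith C f) (p b : ℕ) : MemLp (blockSum a Z f p b) 2 μ :=
  memLp_finsetSum _ fun _ _ => hZ.memLp_comp_maskedWindow hf _ _

lemma measurable_sum_maskedWindow {f : (Fin K → E) → ℝ} {C : ℝ≥0}
    (hf : LipschitzWith C f) (p : ℕ) :
    Measurable fun z : ℤ → E =>
      ∑ s ∈ Finset.range p, f (maskedWindow K a (timeBlock p 0) z (s : ℤ)) :=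
  Finset.measurable_fun_sum _ fun _ _ =>
    (hf.continuous.comp (continuous_maskedWindow _ _)).measurable

omit [IsProbabilityMeasure μ] in
lemma identDistrib_blockSum (hZ : IsIIDNoise μ Z) {f : (Fin K → E) → ℝ} {C : ℝ≥0}
    (hf : LipschitzWith C f) (p b : ℕ) :
    IdentDistrib (blockSum a Z f p b) (blockSum a Z f p 0) μ μ := by
  have h : ∀ b, IdentDistrib (blockSum a Z f p b) ((fun z : ℤ → E => ∑ s ∈ Finset.range p,
      f (maskedWindow K a (timeBlock p 0) z (s : ℤ))) ∘ fun ω t => Z t ω) μ μ := fun b => by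
    rw [show blockSum a Z f p b = _ from funext fun ω => blockSum_eq_shift f p b ω]
    exact (hZ.identDistrib_shift ((b * p : ℕ) : ℤ)).comp (measurable_sum_maskedWindow hf p)
  exact (h b).trans (h 0).symm

omit [IsProbabilityMeasure μ] in
-- Block `b` is a fixed measurable function of the innovations at times `b * p + i` with `i < p`;
-- uniqueness of division with remainder makes these groups disjoint.
lemma iIndepFun_blockSum (hZ : IsIIDNoise μ Z) {f : (Fin K → E) → ℝ} {C : ℝ≥0}
    (hf : LipschitzWith C f) (p : ℕ) : iIndepFun (blockSum a Z f p) μ := by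
  -- The value 0 outside the block is never read, since the mask is `timeBlock p 0`.
  let ext : (Fin p → E) → ℤ → E := fun y u =>
    if h : 0 ≤ u ∧ u < p then y ⟨u.toNat, by omega⟩ else 0
  have hext : Measurable ext := measurable_pi_lambda _ fun u => by
    simp only [ext]
    split_ifs
    · exact measurable_pi_apply _
    · exact measurable_const
  have h1 : iIndepFun (fun (i : ℕ × Fin p) => Z ((i.1 * p + i.2 : ℕ) : ℤ)) μ := by
    refine hZ.indep.precomp fun i j hij => ?_
    have h2 : i.1 * p + i.2 = j.1 * p + j.2 := by exact_mod_cast hij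
    have hi := i.2.2
    have hj := j.2.2
    have hp : 0 < p := by omega
    have h3 : i.1 = j.1 := by
      have := congrArg (· / p) h2
      simpa [Nat.add_div_of_dvd_right, Nat.mul_div_cancel _ hp, Nat.div_eq_of_lt hi,
        Nat.div_eq_of_lt hj] using this
    refine Prod.ext h3 (Fin.ext ?_)
    rw [h3] at h2
    omega
  have h4 := h1.curry fun i => hZ.measurable _
  have h5 := h4.comp (fun _ y => ∑ s ∈ Finset.range p,
    f (maskedWindow K a (timeBlock p 0) (ext y) (s : ℤ)))
    fun _ => (measurable_sum_maskedWindow hf p).comp hext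
  convert h5 using 2 with b
  ext ω
  rw [blockSum_eq_shift]
  refine Finset.sum_congr rfl fun s _ => ?_
  congr 1
  ext κ
  simp only [maskedWindow, maskedSeries]
  refine Finset.sum_congr rfl fun u hu => ?_
  have hu' : 0 ≤ u ∧ u < p := by simpa [timeBlock] using hu
  simp only [ext, dif_pos hu']
  congr 2
  push_cast
  rw [Int.toNat_of_nonneg hu'.1]
  ring

end IsIIDNoise

end Series

end ProbabilityTheory

/-! ### The `L²` error of the block approximation -/

namespace ProbabilityTheory

variable {Ω : Type*} {mΩ : MeasurableSpace Ω} {μ : Measure Ω}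
  {E : Type*} [NormedAddCommGroup E] [NormedSpace ℝ E] [MeasurableSpace E] [BorelSpace E]
  [SecondCountableTopology E] [IsProbabilityMeasure μ] {K : ℕ} {a : ℤ → E →L[ℝ] E}
  {Z : ℤ → Ω → E} {X : ℕ → Ω → E}

/-- Dominated convergence with majorant `R`: a covariance bound summable in the lag and a bound
vanishing uniformly in the lag combine to a vanishing total. -/
lemma tendsto_tsum_min_mul {R : ℤ → ℝ} (hR0 : ∀ h, 0 ≤ R h) (hR : Summable R) {τ : ℕ → ℝ}
    (hτ0 : ∀ s, 0 ≤ τ s) (hτ : Tendsto τ atTop (nhds 0)) :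
    Tendsto (fun s => ∑' h, min (R h) (τ s)) atTop (nhds 0) := by
  have h := tendsto_tsum_of_dominated_convergence (𝓕 := atTop)
    (f := fun s h => min (R h) (τ s)) (g := fun _ => (0 : ℝ)) hR
    (fun h => by
      have h1 := (tendsto_const_nhds (x := R h)).min hτ
      rwa [min_eq_right (hR0 h)] at h1)
    (Eventually.of_forall fun s h => by
      rw [Real.norm_of_nonneg (le_min (hR0 h) (hτ0 s))]
      exact min_le_left _ _)
  rw [tsum_zero] at h
  exact h

/-- Partial sums of a Lipschitz observable of a linear process are approximated in `L²`, up to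
`o(√n)`, by sums of i.i.d. block variables, as the block length goes to infinity. -/
theorem IsLinearSeries.exists_variance_sub_blockSum_le (hX : IsLinearSeries μ a Z X)
    (hZ : IsIIDNoise μ Z) (ha : Summable fun j => ‖a j‖) (ha0 : ∀ j < 0, a j = 0)
    {f : (Fin K → E) → ℝ} {C : ℝ≥0} (hf : LipschitzWith C f) :
    ∃ ε r : ℕ → ℝ, Tendsto ε atTop (nhds 0) ∧ ∀ p, 0 < p → ∀ n,
      Var[fun ω => (∑ t ∈ Finset.range n, f fun κ => X (t + κ) ω) -
        ∑ b ∈ Finset.range (n / p), blockSum a Z f p b ω; μ] ≤ n * ε p + r p := by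
  set Y : ℕ → Ω → ℝ := fun t ω => f fun κ => X (t + κ) ω
  have hY : ∀ t, MemLp (Y t) 2 μ := hX.memLp_window hZ ha hf
  set R : ℤ → ℝ := fun h => 4 * (C * C * (∫ ω, ‖Z 0 ω‖ ^ 2 ∂μ) * lagBound K a h)
  have hz0 : 0 ≤ ∫ ω, ‖Z 0 ω‖ ^ 2 ∂μ := integral_nonneg fun _ => by positivity
  have hR0 : ∀ h, 0 ≤ R h := fun h => by
    have := lagBound_nonneg (K := K) (a := a) h
    positivity
  have hR : Summable R := ((summable_lagBound ha).mul_left _).mul_left _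
  set z : ℝ := (eLpNorm (Z 0) 2 μ).toReal
  have hz : 0 ≤ z := ENNReal.toReal_nonneg
  set w : ℝ := C * ∑ _κ : Fin K, (∑' j, ‖a j‖) * z
  have hw : 0 ≤ w := by positivity
  -- Cauchy–Schwarz bound for an error at block position `s` against an arbitrary error, whose
  -- standard deviation is at most `w`.
  set τ : ℕ → ℝ := fun s => (C * ∑ _κ : Fin K, lagTail a s * z) * w
  have hτ0 : ∀ s, 0 ≤ τ s := fun s => by
    have := lagTail_nonneg (a := a) s
    positivity
  have hτ : Tendsto τ atTop (nhds 0) := by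
    have h2 : Tendsto (fun s => ∑ _κ : Fin K, lagTail a s * z) atTop
        (nhds (∑ _κ : Fin K, 0 * z)) :=
      tendsto_finsetSum _ fun κ _ => (tendsto_lagTail ha).mul_const _
    simpa only [zero_mul, Finset.sum_const_zero, mul_zero] using
      (h2.const_mul (C : ℝ)).mul_const w
  set Ψ : ℝ := ∑' h, R h
  have hΨ : 0 ≤ Ψ := tsum_nonneg hR0
  set ψ : ℕ → ℝ := fun s => ∑' h, min (R h) (τ s)
  have hψ0 : ∀ s, 0 ≤ ψ s := fun s => tsum_nonneg fun h => le_min (hR0 h) (hτ0 s)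
  have hψ : Tendsto ψ atTop (nhds 0) := tendsto_tsum_min_mul hR0 hR hτ0 hτ
  -- The rate is the Cesàro mean of `ψ` plus the cost of at most `K` windows per block that may
  -- leave it; `r p` pays for the incomplete last block of fewer than `p` terms. The factor 2 comes
  -- from separating these two sums.
  refine ⟨fun p => 2 * ((p : ℝ)⁻¹ * ∑ s ∈ Finset.range p, ψ s + (p : ℝ)⁻¹ * (K * Ψ)),
    fun p => 2 * (p * Ψ), ?_, fun p hp n => ?_⟩
  · have h1 := (hψ.cesaro.add ((tendsto_inv_atTop_nhds_zero_nat (𝕜 := ℝ)).mul_const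
      (K * Ψ))).const_mul 2
    simpa using h1
  -- the errors of the block approximation
  set V : ℕ → Ω → ℝ := fun t ω =>
    f (maskedWindow K a (timeBlock p (t / p)) (fun u => Z u ω) t)
  have hV : ∀ t, MemLp (V t) 2 μ := fun t => hZ.memLp_comp_maskedWindow hf _ _
  set D : ℕ → Ω → ℝ := fun t ω => Y t ω - V t ω
  have hD : ∀ t, MemLp (D t) 2 μ := fun t => (hY t).sub (hV t)
  have hDw : ∀ t, √(Var[D t; μ]) ≤ w := fun t =>
    (hX.sqrt_variance_sub_masked_le hZ ha hf t _).trans (by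
      simp only [w]
      gcongr with κ
      exact maskTail_le ha _ _)
  -- When the window stays inside the block, each entry sees at least the last `t % p` lags through
  -- the mask.
  have hDτ : ∀ t, t % p + K ≤ p → √(Var[D t; μ]) ≤ C * ∑ _κ : Fin K, lagTail a (t % p) * z :=
    fun t ht => (hX.sqrt_variance_sub_masked_le hZ ha hf t _).trans (by
      gcongr with κ
      refine maskTail_le_lagTail ha ha0 fun u hu1 hu2 => ?_
      have h1 := Nat.div_add_mod t p
      have h2 := Nat.mod_lt t hp
      have h3 := κ.2
      rw [mul_comm] at h1
      rw [timeBlock, Finset.mem_Ico]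
      constructor
      · omega
      · omega)
  have hDR : ∀ t s, |cov[D t, D s; μ]| ≤ R (t - s) := fun t s =>
    (hX.isMaskedLimit hZ ha hf t).abs_covariance_sub_le hZ ha hf (hZ.isMaskedLimit hf _ _)
      (hX.isMaskedLimit hZ ha hf s) (hZ.isMaskedLimit hf _ _)
  have hYR : ∀ t s, |cov[Y t, Y s; μ]| ≤ R (t - s) := fun t s => by
    have h1 := (hX.isMaskedLimit hZ ha hf t).abs_covariance_le hZ ha hf hf
      (hX.isMaskedLimit hZ ha hf s)
    have h2 := abs_nonneg (cov[Y t, Y s; μ])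
    simp only [R]
    linarith
  set q : ℕ → ℤ → ℝ := fun t h => if t % p + K ≤ p then min (R h) (τ (t % p)) else R h
  have hq0 : ∀ t h, 0 ≤ q t h := fun t h => by
    simp only [q]
    split_ifs
    exacts [le_min (hR0 h) (hτ0 _), hR0 h]
  have hqR : ∀ t h, q t h ≤ R h := fun t h => by
    simp only [q]
    split_ifs
    exacts [min_le_left _ _, le_rfl]
  have hq : ∀ t, Summable (q t) := fun t => hR.of_nonneg_of_le (hq0 t) (hqR t)
  have hDq : ∀ t s, |cov[D t, D s; μ]| ≤ q t (t - s) := fun t s => by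
    simp only [q]
    split_ifs with ht
    · refine le_min (hDR t s) ((abs_covariance_le_sqrt_variance (hD t) (hD s)).trans ?_)
      exact mul_le_mul (hDτ t ht) (hDw s) (Real.sqrt_nonneg _)
        ((Real.sqrt_nonneg _).trans (hDτ t ht))
    · exact hDR t s
  -- the two parts of the sum
  set N := n / p * p
  have hNn : N ≤ n := Nat.div_mul_le_self n p
  have hsplit : ∀ ω, (∑ t ∈ Finset.range n, Y t ω) -
      ∑ b ∈ Finset.range (n / p), blockSum a Z f p b ω =
      (∑ t ∈ Finset.range N, D t ω) + ∑ t ∈ Finset.Ico N n, Y t ω := fun ω => by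
    have h1 : ∑ b ∈ Finset.range (n / p), blockSum a Z f p b ω =
        ∑ t ∈ Finset.range N, V t ω := by
      rw [Finset.sum_range_mul_eq]
      refine Finset.sum_congr rfl fun b _ => Finset.sum_congr rfl fun s hs => ?_
      have hs := Finset.mem_range.1 hs
      have h2 : (b * p + s) / p = b := by
        rw [mul_comm, Nat.mul_add_div hp, Nat.div_eq_of_lt hs, add_zero]
      simp only [V, h2]
    rw [h1, ← Finset.sum_range_add_sum_Ico _ hNn]
    simp only [D, Finset.sum_sub_distrib]
    ring
  have hvar1 : Var[fun ω => ∑ t ∈ Finset.range N, D t ω; μ] ≤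
      n * ((p : ℝ)⁻¹ * ∑ s ∈ Finset.range p, ψ s + (p : ℝ)⁻¹ * (K * Ψ)) := by
    refine (variance_sum_le_sum_tsum _ (fun t _ => hD t) hq0 hq fun t _ s _ => hDq t s).trans ?_
    rw [Finset.sum_range_mul_eq]
    have hone : ∑ s ∈ Finset.range p, (if s + K ≤ p then ψ s else Ψ) ≤
        ∑ s ∈ Finset.range p, ψ s + K * Ψ := by
      have h1 : ∀ s ∈ Finset.range p, (if s + K ≤ p then ψ s else Ψ) ≤
          ψ s + if p < s + K then Ψ else 0 := fun s _ => by
        split_ifs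
        · omega
        · simp
        · simp [hψ0 s]
        · omega
      refine (Finset.sum_le_sum h1).trans ?_
      rw [Finset.sum_add_distrib, ← Finset.sum_filter, Finset.sum_const, nsmul_eq_mul]
      gcongr
      have h2 : (Finset.range p).filter (fun s => p < s + K) ⊆ Finset.Ico (p - K) p := by
        intro s hs
        simp only [Finset.mem_filter, Finset.mem_range, Finset.mem_Ico] at hs ⊢
        omega
      refine (Finset.card_le_card h2).trans ?_
      simp
      omega
    have hblock : ∀ b, ∑ s ∈ Finset.range p, ∑' h, q (b * p + s) h =
        ∑ s ∈ Finset.range p, (if s + K ≤ p then ψ s else Ψ) := fun b =>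
      Finset.sum_congr rfl fun s hs => by
        have h2 : (b * p + s) % p = s := by
          rw [Nat.mul_add_mod', Nat.mod_eq_of_lt (Finset.mem_range.1 hs)]
        simp only [q, h2]
        split_ifs <;> rfl
    simp only [hblock, Finset.sum_const, Finset.card_range, nsmul_eq_mul]
    have h3 : ((n / p : ℕ) : ℝ) ≤ n * (p : ℝ)⁻¹ := by
      rw [← div_eq_mul_inv]
      exact Nat.cast_div_le
    have h4 : 0 ≤ ∑ s ∈ Finset.range p, ψ s + K * Ψ :=
      add_nonneg (Finset.sum_nonneg fun s _ => hψ0 s) (by positivity)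
    calc _ ≤ ((n / p : ℕ) : ℝ) * (∑ s ∈ Finset.range p, ψ s + K * Ψ) := by gcongr
      _ ≤ (n * (p : ℝ)⁻¹) * (∑ s ∈ Finset.range p, ψ s + K * Ψ) := by gcongr
      _ = _ := by ring
  have hvar2 : Var[fun ω => ∑ t ∈ Finset.Ico N n, Y t ω; μ] ≤ p * Ψ := by
    refine (variance_sum_le_sum_tsum _ (q := fun _ => R) (fun t _ => hY t) (fun _ => hR0)
      (fun _ => hR) fun t _ s _ => hYR t s).trans ?_
    rw [Finset.sum_const, nsmul_eq_mul, Nat.card_Ico]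
    gcongr
    have := Nat.div_add_mod' n p
    have := Nat.mod_lt n hp
    omega
  have hfin : Var[fun ω => (∑ t ∈ Finset.range n, Y t ω) -
      ∑ b ∈ Finset.range (n / p), blockSum a Z f p b ω; μ] ≤
      2 * (Var[fun ω => ∑ t ∈ Finset.range N, D t ω; μ] +
        Var[fun ω => ∑ t ∈ Finset.Ico N n, Y t ω; μ]) := by
    simp only [hsplit]
    exact variance_add_le_two_mul (memLp_finsetSum _ fun t _ => hD t)
      (memLp_finsetSum _ fun t _ => hY t)
  linarith

end ProbabilityTheory

/-! ### Central limit theorem by comparison with i.i.d. blocks -/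

namespace ProbabilityTheory

variable {Ω : Type*} {mΩ : MeasurableSpace Ω} {μ : Measure Ω} [IsProbabilityMeasure μ]

/-- The characteristic function at `1` of the centered random variable `U - E U`. -/
noncomputable def centeredChar (μ : Measure Ω) (U : Ω → ℝ) : ℂ :=
  ∫ ω, Complex.exp (Complex.I * ((U ω - ∫ ω', U ω' ∂μ : ℝ) : ℂ)) ∂μ

lemma norm_exp_I_mul_sub_le (x y : ℝ) :
    ‖Complex.exp (Complex.I * (x : ℂ)) - Complex.exp (Complex.I * (y : ℂ))‖ ≤ |x - y| := by
  have h : Complex.exp (Complex.I * (x : ℂ)) - Complex.exp (Complex.I * (y : ℂ)) =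
      Complex.exp (Complex.I * (y : ℂ)) * (Complex.exp (Complex.I * ((x - y : ℝ) : ℂ)) - 1) := by
    rw [mul_sub, ← Complex.exp_add, mul_one]
    congr 2
    push_cast
    ring
  rw [h, norm_mul, Complex.norm_exp_I_mul_ofReal, one_mul]
  exact Real.norm_exp_I_mul_ofReal_sub_one_le

lemma integral_abs_sub_integral_le {U : Ω → ℝ} (hU : MemLp U 2 μ) :
    ∫ ω, |U ω - ∫ ω', U ω' ∂μ| ∂μ ≤ √(Var[U; μ]) := by
  have h1 : MemLp (fun ω => U ω - ∫ ω', U ω' ∂μ) 2 μ := hU.sub (memLp_const _)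
  -- Nonnegativity of this variance is the inequality between the first and second absolute moments.
  have h2 := variance_nonneg (fun ω => |U ω - ∫ ω', U ω' ∂μ|) μ
  have h3 : MemLp (fun ω => |U ω - ∫ ω', U ω' ∂μ|) 2 μ := h1.norm
  rw [variance_eq_sub h3] at h2
  apply Real.le_sqrt_of_sq_le
  rw [variance_eq_integral hU.aestronglyMeasurable.aemeasurable]
  simpa using h2

/-- The map `x ↦ exp (i x)` is 1-Lipschitz, so variance estimates alone control characteristic
functions. -/
lemma norm_centeredChar_sub_le {U V : Ω → ℝ} (hU : MemLp U 2 μ) (hV : MemLp V 2 μ) :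
    ‖centeredChar μ U - centeredChar μ V‖ ≤ √(Var[fun ω => U ω - V ω; μ]) := by
  have hint : ∀ {U : Ω → ℝ}, MemLp U 2 μ →
      Integrable (fun ω => Complex.exp (Complex.I * ((U ω - ∫ ω', U ω' ∂μ : ℝ) : ℂ))) μ := by
    intro U hU
    have hm : AEMeasurable U μ := hU.aestronglyMeasurable.aemeasurable
    refine (integrable_const (1 : ℝ)).mono' ?_
      (ae_of_all _ fun ω => (Complex.norm_exp_I_mul_ofReal _).le)
    exact AEMeasurable.aestronglyMeasurable (by fun_prop)
  have hW : MemLp (fun ω => U ω - V ω) 2 μ := hU.sub hV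
  refine le_trans ?_ (integral_abs_sub_integral_le hW)
  rw [centeredChar, centeredChar, ← integral_sub (hint hU) (hint hV)]
  refine norm_integral_le_of_norm_le ?_ (ae_of_all _ fun ω => ?_)
  · exact ((hW.sub (memLp_const _)).norm.integrable (by norm_num))
  · refine (norm_exp_I_mul_sub_le _ _).trans_eq ?_
    rw [integral_sub (hU.integrable (by norm_num)) (hV.integrable (by norm_num))]
    congr 1
    ring

/-- The central limit theorem for i.i.d. variables in terms of `centeredChar`. -/
lemma tendsto_centeredChar_iid {B : ℕ → Ω → ℝ} (hB : MemLp (B 0) 2 μ) (hindep : iIndepFun B μ)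
    (hident : ∀ i, IdentDistrib (B i) (B 0) μ μ) :
    Tendsto (fun q : ℕ => centeredChar μ fun ω => (√q)⁻¹ * ∑ b ∈ Finset.range q, B b ω) atTop
      (nhds (Complex.exp (-(Var[B 0; μ] : ℂ) / 2))) := by
  have h := (tendstoInDistribution_inv_sqrt_mul_sum_sub
    (P' := gaussianReal 0 (Var[B 0; μ]).toNNReal) HasLaw.id hB hindep hident)
  have h2 := ProbabilityMeasure.tendsto_iff_tendsto_charFun.1 h.tendsto 1
  have hm : ∀ i, AEMeasurable (B i) μ := fun i => (hident i).aemeasurable_fst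
  simp only [ProbabilityMeasure.coe_mk, Measure.map_id, charFun_gaussianReal] at h2
  convert h2 using 2 with q
  · rw [charFun_apply_real, integral_map (h.forall_aemeasurable q) (by fun_prop), centeredChar]
    congr 1 with ω
    have h3 : ∫ ω', (√q)⁻¹ * ∑ b ∈ Finset.range q, B b ω' ∂μ = (√q)⁻¹ * (q * ∫ ω, B 0 ω ∂μ) := by
      rw [integral_const_mul, integral_finsetSum _ fun b _ =>
        ((hident b).memLp_iff.2 hB).integrable (by norm_num)]
      simp [fun b => (hident b).integral_eq]
    rw [h3]
    congr 1
    push_cast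
    ring
  · have h4 : ((Var[B 0; μ]).toNNReal : ℂ) = (Var[B 0; μ] : ℂ) := by
      norm_cast
      exact Real.coe_toNNReal _ (variance_nonneg _ _)
    congr 1
    rw [h4]
    simp
    ring

lemma tendsto_natCast_div_div {p : ℕ} (hp : 0 < p) :
    Tendsto (fun n : ℕ => ((n / p : ℕ) : ℝ) / n) atTop (nhds (p : ℝ)⁻¹) := by
  have h := (tendsto_nat_floor_mul_div_atTop (R := ℝ) (a := (p : ℝ)⁻¹) (by positivity)).comp
    tendsto_natCast_atTop_atTop
  refine h.congr fun n => ?_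
  simp only [Function.comp_apply]
  rw [inv_mul_eq_div, Nat.floor_div_natCast, Nat.floor_natCast]

omit [IsProbabilityMeasure μ] in
lemma variance_sum_iid {B : ℕ → Ω → ℝ} (hB : MemLp (B 0) 2 μ) (hindep : iIndepFun B μ)
    (hident : ∀ i, IdentDistrib (B i) (B 0) μ μ) (q : ℕ) :
    Var[fun ω => ∑ b ∈ Finset.range q, B b ω; μ] = q * Var[B 0; μ] := by
  have h := IndepFun.variance_sum (s := Finset.range q) (X := B) (μ := μ)
    (fun i _ => (hident i).memLp_iff.2 hB) fun i _ j _ hij => hindep.indepFun hij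
  have h2 : (fun ω => ∑ b ∈ Finset.range q, B b ω) = ∑ b ∈ Finset.range q, B b := by
    ext ω
    simp
  rw [h2, h]
  simp [fun b => (hident b).variance_eq]

omit [IsProbabilityMeasure μ] in
lemma variance_inv_sqrt_mul (U : Ω → ℝ) (n : ℕ) :
    Var[fun ω => (√n)⁻¹ * U ω; μ] = (n : ℝ)⁻¹ * Var[U; μ] := by
  rw [variance_const_mul, inv_pow, Real.sq_sqrt (Nat.cast_nonneg n)]

/-- For sums of i.i.d. blocks, the normalization by the number of blocks can be replaced by
the number of summands. -/
lemma tendsto_centeredChar_blocks {B : ℕ → Ω → ℝ} (hB : MemLp (B 0) 2 μ) (hindep : iIndepFun B μ)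
    (hident : ∀ i, IdentDistrib (B i) (B 0) μ μ) {p : ℕ} (hp : 0 < p) :
    Tendsto (fun n : ℕ => centeredChar μ fun ω => (√n)⁻¹ * ∑ b ∈ Finset.range (n / p), B b ω) atTop
      (nhds (Complex.exp (-((Var[B 0; μ] / p : ℝ) : ℂ) / 2))) := by
  have hp' : (0 : ℝ) < p := by exact_mod_cast hp
  have hB' : ∀ i, MemLp (B i) 2 μ := fun i => (hident i).memLp_iff.2 hB
  have hS : ∀ q, MemLp (fun ω => ∑ b ∈ Finset.range q, B b ω) 2 μ := fun q =>
    memLp_finsetSum _ fun i _ => hB' i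
  have hdiv : Tendsto (fun n : ℕ => n / p) atTop atTop := Nat.tendsto_div_const_atTop hp.ne'
  have h1 := (tendsto_centeredChar_iid (B := fun b ω => (√p)⁻¹ * B b ω) (hB.const_mul _)
    (hindep.comp (fun _ x => (√p)⁻¹ * x) fun _ => by fun_prop)
    fun i => (hident i).comp (u := fun x => (√p)⁻¹ * x) (by fun_prop)).comp hdiv
  rw [variance_inv_sqrt_mul, inv_mul_eq_div] at h1
  have h2 : Tendsto (fun n : ℕ => |√(((n / p : ℕ) : ℝ) / n * Var[B 0; μ]) - √((p : ℝ)⁻¹ *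
      Var[B 0; μ])|) atTop (nhds 0) := by
    have h3 := (((tendsto_natCast_div_div hp).mul_const (Var[B 0; μ])).sqrt.sub_const
      (√((p : ℝ)⁻¹ * Var[B 0; μ]))).abs
    simpa using h3
  -- Both normalizations multiply the same block sum by constants, so the standard deviation of the
  -- difference is explicit, and it vanishes because `(n / p) / n → 1 / p`.
  have h4 : Tendsto (fun n : ℕ =>
      (centeredChar μ fun ω => (√n)⁻¹ * ∑ b ∈ Finset.range (n / p), B b ω) -
      centeredChar μ fun ω => (√(n / p : ℕ))⁻¹ * ∑ b ∈ Finset.range (n / p), (√p)⁻¹ * B b ω)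
      atTop (nhds 0) := by
    refine squeeze_zero_norm' ?_ h2
    filter_upwards [hdiv.eventually_gt_atTop 0] with n hn
    refine (norm_centeredChar_sub_le ((hS _).const_mul _)
      ((memLp_finsetSum _ fun i _ => (hB' i).const_mul _).const_mul _)).trans_eq ?_
    have h5 : (fun ω => (√n)⁻¹ * ∑ b ∈ Finset.range (n / p), B b ω -
        (√(n / p : ℕ))⁻¹ * ∑ b ∈ Finset.range (n / p), (√p)⁻¹ * B b ω) = fun ω =>
        ((√n)⁻¹ - (√(n / p : ℕ))⁻¹ * (√p)⁻¹) * ∑ b ∈ Finset.range (n / p), B b ω := by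
      ext ω
      rw [← Finset.mul_sum]
      ring
    have hq : (0 : ℝ) < ((n / p : ℕ) : ℝ) := by exact_mod_cast hn
    rw [h5, variance_const_mul, variance_sum_iid hB hindep hident,
      Real.sqrt_mul (sq_nonneg _), Real.sqrt_sq_eq_abs, Real.sqrt_mul hq.le,
      Real.sqrt_mul (by positivity), Real.sqrt_mul (by positivity), Real.sqrt_div hq.le,
      Real.sqrt_inv, ← sub_mul, abs_mul, abs_of_nonneg (Real.sqrt_nonneg (Var[B 0; μ])),
      ← mul_assoc]
    congr 1
    rw [← abs_of_pos (Real.sqrt_pos.2 hq), ← abs_mul, abs_of_pos (Real.sqrt_pos.2 hq)]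
    congr 1
    have := (Real.sqrt_pos.2 hq).ne'
    field_simp
  have h6 := h4.add h1
  simpa using h6

/-- A central limit theorem for sequences that are approximated in `L²` by sums of i.i.d. blocks. -/
theorem tendsto_centeredChar_of_blocks {S : ℕ → Ω → ℝ} (hS : ∀ n, MemLp (S n) 2 μ)
    {B : ℕ → ℕ → Ω → ℝ} (hB : ∀ p, MemLp (B p 0) 2 μ) (hindep : ∀ p, iIndepFun (B p) μ)
    (hident : ∀ p i, IdentDistrib (B p i) (B p 0) μ μ) {v : ℝ}
    (hv : Tendsto (fun n : ℕ => (n : ℝ)⁻¹ * Var[S n; μ]) atTop (nhds v)) {ε r : ℕ → ℝ}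
    (hε : Tendsto ε atTop (nhds 0)) (happ : ∀ p, 0 < p → ∀ n,
      Var[fun ω => S n ω - ∑ b ∈ Finset.range (n / p), B p b ω; μ] ≤ n * ε p + r p) :
    Tendsto (fun n : ℕ => centeredChar μ fun ω => (√n)⁻¹ * S n ω) atTop
      (nhds (Complex.exp (-(v : ℂ) / 2))) := by
  have hv0 : 0 ≤ v := ge_of_tendsto hv (Eventually.of_forall fun n => by
    have := variance_nonneg (S n) μ
    positivity)
  have hT : ∀ p q, MemLp (fun ω => ∑ b ∈ Finset.range q, B p b ω) 2 μ := fun p q =>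
    memLp_finsetSum _ fun i _ => (hident p i).memLp_iff.2 (hB p)
  have herr : ∀ p, Tendsto (fun n : ℕ => √(ε p + (n : ℝ)⁻¹ * r p)) atTop (nhds √(ε p)) := by
    intro p
    have := ((((tendsto_inv_atTop_nhds_zero_nat (𝕜 := ℝ)).mul_const (r p))).const_add (ε p)).sqrt
    simpa using this
  have hdist : ∀ p, 0 < p → ∀ n : ℕ, 0 < n →
      √(Var[fun ω => (√n)⁻¹ * S n ω - (√n)⁻¹ * ∑ b ∈ Finset.range (n / p), B p b ω; μ]) ≤
        √(ε p + (n : ℝ)⁻¹ * r p) := by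
    intro p hp n hn
    have hn' : (0 : ℝ) < n := by exact_mod_cast hn
    simp only [← mul_sub]
    rw [variance_inv_sqrt_mul]
    apply Real.sqrt_le_sqrt
    calc (n : ℝ)⁻¹ * Var[fun ω => S n ω - ∑ b ∈ Finset.range (n / p), B p b ω; μ]
        ≤ (n : ℝ)⁻¹ * (n * ε p + r p) := by
          gcongr
          exact happ p hp n
      _ = _ := by field_simp
  -- Reverse triangle inequality for standard deviations, in the limit `n → ∞`; the block variances
  -- thus need no direct computation.
  have hvp : ∀ p, 0 < p → |√v - √(Var[B p 0; μ] / p)| ≤ √(ε p) := by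
    intro p hp
    have h1 : Tendsto (fun n : ℕ => (n : ℝ)⁻¹ *
        Var[fun ω => ∑ b ∈ Finset.range (n / p), B p b ω; μ]) atTop
        (nhds (Var[B p 0; μ] / p)) := by
      have h2 := (tendsto_natCast_div_div hp).mul_const (Var[B p 0; μ])
      rw [inv_mul_eq_div] at h2
      refine h2.congr fun n => ?_
      rw [variance_sum_iid (hB p) (hindep p) (hident p)]
      ring
    refine le_of_tendsto_of_tendsto (hv.sqrt.sub h1.sqrt).abs (herr p) ?_
    filter_upwards [eventually_gt_atTop 0] with n hn
    refine le_trans ?_ (hdist p hp n hn)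
    rw [← variance_inv_sqrt_mul, ← variance_inv_sqrt_mul]
    exact abs_sqrt_variance_sub_le ((hS n).const_mul _) ((hT p _).const_mul _)
  have hvlim : Tendsto (fun p : ℕ => Var[B p 0; μ] / p) atTop (nhds v) := by
    have h1 : Tendsto (fun p : ℕ => √(Var[B p 0; μ] / p)) atTop (nhds √v) := by
      rw [tendsto_iff_norm_sub_tendsto_zero]
      have h2 : Tendsto (fun p => √(ε p)) atTop (nhds 0) := by simpa using hε.sqrt
      refine squeeze_zero' (Eventually.of_forall fun _ => norm_nonneg _) ?_ h2
      filter_upwards [eventually_gt_atTop 0] with p hp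
      rw [norm_sub_rev]
      exact hvp p hp
    have h3 := h1.pow 2
    rw [Real.sq_sqrt hv0] at h3
    refine h3.congr fun p => Real.sq_sqrt ?_
    have := variance_nonneg (B p 0) μ
    positivity
  -- The limiting error in `n` for fixed `p`: block replacement, the i.i.d. theorem (contributing
  -- 0), and the change of Gaussian variance. First `p` is chosen to make it small, then `n`.
  have hc : Tendsto (fun p : ℕ => √(ε p) + (0 +
      ‖Complex.exp (-((Var[B p 0; μ] / p : ℝ) : ℂ) / 2) - Complex.exp (-(v : ℂ) / 2)‖))
      atTop (nhds 0) := by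
    have h1 : Continuous fun x : ℝ => Complex.exp (-(x : ℂ) / 2) := by fun_prop
    have h2 := ((h1.tendsto v).comp hvlim).sub_const (Complex.exp (-(v : ℂ) / 2))
    have h3 := hε.sqrt.add (h2.norm.const_add 0)
    simpa using h3
  rw [Metric.tendsto_nhds]
  intro δ hδ
  obtain ⟨p, hpδ, hp⟩ := ((hc.eventually (gt_mem_nhds hδ)).and (eventually_gt_atTop 0)).exists
  have hblocks := tendsto_centeredChar_blocks (hB p) (hindep p) (hident p) hp
  have hn := (herr p).add
    ((tendsto_iff_norm_sub_tendsto_zero.1 hblocks).add_const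
      ‖Complex.exp (-((Var[B p 0; μ] / p : ℝ) : ℂ) / 2) - Complex.exp (-(v : ℂ) / 2)‖)
  filter_upwards [hn.eventually (gt_mem_nhds hpδ), eventually_gt_atTop 0] with n hn1 hn2
  refine lt_of_le_of_lt ?_ hn1
  have h1 := (norm_centeredChar_sub_le ((hS n).const_mul _) ((hT p (n / p)).const_mul _)).trans
    (hdist p hp n hn2)
  rw [dist_eq_norm]
  refine (norm_sub_le_norm_sub_add_norm_sub _
    (centeredChar μ fun ω => (√n)⁻¹ * ∑ b ∈ Finset.range (n / p), B p b ω) _).trans ?_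
  refine add_le_add h1 ?_
  exact norm_sub_le_norm_sub_add_norm_sub _ _ _

lemma tendsto_centeredChar_of_variance_sub_le {S G : ℕ → Ω → ℝ} (hS : ∀ n, MemLp (S n) 2 μ)
    (hG : ∀ n, MemLp (G n) 2 μ) {c : ℝ} (hc : ∀ n, Var[fun ω => G n ω - S n ω; μ] ≤ c) {L : ℂ}
    (h : Tendsto (fun n : ℕ => centeredChar μ fun ω => (√n)⁻¹ * S n ω) atTop (nhds L)) :
    Tendsto (fun n : ℕ => centeredChar μ fun ω => (√n)⁻¹ * G n ω) atTop (nhds L) := by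
  have h1 : Tendsto (fun n : ℕ => √((n : ℝ)⁻¹ * c)) atTop (nhds 0) := by
    have := ((tendsto_inv_atTop_nhds_zero_nat (𝕜 := ℝ)).mul_const c).sqrt
    simpa using this
  have h2 : Tendsto (fun n : ℕ => (centeredChar μ fun ω => (√n)⁻¹ * G n ω) -
      centeredChar μ fun ω => (√n)⁻¹ * S n ω) atTop (nhds 0) := by
    refine squeeze_zero_norm (fun n => ?_) h1
    refine (norm_centeredChar_sub_le ((hG n).const_mul _) ((hS n).const_mul _)).trans ?_
    simp only [← mul_sub]
    rw [variance_inv_sqrt_mul]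
    gcongr
    exact hc n
  simpa using h2.add h

end ProbabilityTheory

/-! ### The network as a Lipschitz function of a window -/

namespace FCN

lemma abs_mulVec_sub_le {p q : ℕ} (M : Matrix (Fin q) (Fin p) ℝ) (v w : Vec p) (r : Fin q) :
    |(M *ᵥ v.ofLp) r - (M *ᵥ w.ofLp) r| ≤
      ‖(Matrix.toEuclideanLin M).toContinuousLinearMap‖ * ‖v - w‖ := by
  have h := (Matrix.toEuclideanLin M).toContinuousLinearMap.le_opNorm (v - w)
  refine le_trans ?_ h
  rw [map_sub]
  refine le_trans (le_of_eq ?_) (PiLp.norm_apply_le _ r)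
  rw [Real.norm_eq_abs]
  rfl

lemma norm_le_sum_abs {q : ℕ} (v : Vec q) : ‖v‖ ≤ ∑ r, |v r| := by
  rw [EuclideanSpace.norm_eq]
  refine Real.sqrt_le_iff.2 ⟨Finset.sum_nonneg fun _ _ => abs_nonneg _, ?_⟩
  exact Finset.sum_sq_le_sq_sum_of_nonneg fun _ _ => abs_nonneg _

/-- A convolutional layer with a Lipschitz activation is Lipschitz in the `k` inputs that it
uses. -/
lemma exists_norm_convLayer_sub_le {σ : ℝ → ℝ} {C : ℝ≥0} (hσ : LipschitzWith C σ) {p q k : ℕ}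
    (hk : 1 ≤ k) (b : Vec q) (I : Matrix (Fin q) (Fin p) ℝ)
    (W : Fin k → Matrix (Fin q) (Fin p) ℝ) :
    ∃ c : ℝ, 0 ≤ c ∧ ∀ (h h' : ℕ → Vec p) (t : ℕ),
      ‖convLayer σ b I W h t - convLayer σ b I W h' t‖ ≤
        c * ∑ j ∈ Finset.range k, ‖h (t + j) - h' (t + j)‖ := by
  set i0 : ℝ := ‖(Matrix.toEuclideanLin I).toContinuousLinearMap‖
  set w : Fin k → ℝ := fun j => ‖(Matrix.toEuclideanLin (W j)).toContinuousLinearMap‖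
  have hw : ∀ j, 0 ≤ w j := fun j => norm_nonneg _
  -- The factor `q` comes from bounding the Euclidean norm by the sum over coordinates.
  refine ⟨q * (i0 + C * ∑ j, w j), by positivity, fun h h' t => ?_⟩
  set D : ℝ := ∑ j ∈ Finset.range k, ‖h (t + j) - h' (t + j)‖
  have hD : ∀ j < k, ‖h (t + j) - h' (t + j)‖ ≤ D := fun j hj =>
    Finset.single_le_sum (f := fun j => ‖h (t + j) - h' (t + j)‖) (fun _ _ => norm_nonneg _)
      (Finset.mem_range.2 hj)
  have hcoord : ∀ r, |(convLayer σ b I W h t - convLayer σ b I W h' t) r| ≤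
      (i0 + C * ∑ j, w j) * D := fun r => by
    -- The residual term reads time `t`, which is among the summands of `D` because `1 ≤ k`.
    have h1 : |(I *ᵥ (h t).ofLp) r - (I *ᵥ (h' t).ofLp) r| ≤ i0 * D :=
      (abs_mulVec_sub_le I _ _ r).trans (by
        gcongr
        exact hD 0 hk)
    have h2 : |(∑ j : Fin k, (W j *ᵥ (h (t + (j : ℕ))).ofLp) r) -
        ∑ j : Fin k, (W j *ᵥ (h' (t + (j : ℕ))).ofLp) r| ≤ (∑ j, w j) * D := by
      rw [← Finset.sum_sub_distrib, Finset.sum_mul]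
      refine (Finset.abs_sum_le_sum_abs _ _).trans (Finset.sum_le_sum fun j _ => ?_)
      refine (abs_mulVec_sub_le (W j) _ _ r).trans ?_
      exact mul_le_mul_of_nonneg_left (hD j j.2) (hw j)
    have h3 := hσ.dist_le_mul (b r + ∑ j : Fin k, (W j *ᵥ (h (t + (j : ℕ))).ofLp) r)
      (b r + ∑ j : Fin k, (W j *ᵥ (h' (t + (j : ℕ))).ofLp) r)
    rw [Real.dist_eq, Real.dist_eq, add_sub_add_left_eq_sub] at h3
    have h4 : (C : ℝ) * |(∑ j : Fin k, (W j *ᵥ (h (t + (j : ℕ))).ofLp) r) -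
        ∑ j : Fin k, (W j *ᵥ (h' (t + (j : ℕ))).ofLp) r| ≤ C * ((∑ j, w j) * D) := by gcongr
    simp only [convLayer, PiLp.sub_apply]
    rw [add_sub_add_comm]
    refine (abs_add_le _ _).trans ?_
    linarith
  refine (norm_le_sum_abs _).trans ((Finset.sum_le_sum fun r _ => hcoord r).trans_eq ?_)
  rw [Finset.sum_const, Finset.card_univ, Fintype.card_fin, nsmul_eq_mul]
  ring

namespace ResFCN

variable {L : ℕ} {m : Fin (L + 1) → ℕ} {k : Fin L → ℕ}

lemma hidden_zero (N : ResFCN L m k) (σ : ℝ → ℝ) (x : ℕ → Vec (m 0)) : N.hidden σ x 0 = x := rfl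

lemma hidden_succ (N : ResFCN L m k) (σ : ℝ → ℝ) (x : ℕ → Vec (m 0)) (i : Fin L) :
    N.hidden σ x i.succ =
      convLayer σ (N.bias i) (N.skip i) (N.filter i) (N.hidden σ x i.castSucc) :=
  Fin.induction_succ ..

/-- How many time steps ahead the activations of a layer look. -/
def lookahead (k : Fin L → ℕ) (ℓ : Fin (L + 1)) : ℕ :=
  ∑ i : Fin L, if i.castSucc < ℓ then k i - 1 else 0

lemma lookahead_succ (k : Fin L → ℕ) (i : Fin L) :
    lookahead k i.succ = lookahead k i.castSucc + (k i - 1) := by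
  have h : ∀ j : Fin L, (if j.castSucc < i.succ then k j - 1 else 0) =
      (if j.castSucc < i.castSucc then k j - 1 else 0) + if j = i then k j - 1 else 0 := by
    intro j
    simp only [Fin.lt_def, Fin.ext_iff, Fin.val_castSucc, Fin.val_succ]
    split_ifs <;> omega
  simp only [lookahead, h, Finset.sum_add_distrib, Finset.sum_ite_eq', Finset.mem_univ, if_true]

lemma windowLength_eq (hk : ∀ i, 1 ≤ k i) : windowLength k = lookahead k (Fin.last L) + 1 := by
  have h1 : ∑ i, k i = (∑ i, (k i - 1)) + L := by
    have h2 : ∑ i, k i = ∑ i, ((k i - 1) + 1) :=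
      Finset.sum_congr rfl fun i _ => (Nat.sub_add_cancel (hk i)).symm
    rw [h2, Finset.sum_add_distrib]
    simp
  simp only [windowLength, lookahead, Fin.castSucc_lt_last, if_true]
  omega

/-- The activations are Lipschitz in the inputs inside the lookahead, and depend on no others. -/
lemma exists_norm_hidden_sub_le (N : ResFCN L m k) {σ : ℝ → ℝ} {C : ℝ≥0} (hσ : LipschitzWith C σ)
    (hk : ∀ i, 1 ≤ k i) (ℓ : Fin (L + 1)) :
    ∃ c : ℝ, 0 ≤ c ∧ ∀ (x y : ℕ → Vec (m 0)) (t : ℕ),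
      ‖N.hidden σ x ℓ t - N.hidden σ y ℓ t‖ ≤
        c * ∑ s ∈ Finset.range (lookahead k ℓ + 1), ‖x (t + s) - y (t + s)‖ := by
  induction ℓ using Fin.induction with
  | zero => exact ⟨1, zero_le_one, fun x y t => by simp [hidden_zero, lookahead]⟩
  | succ i ih =>
    obtain ⟨c, hc, ih⟩ := ih
    obtain ⟨d, hd, hconv⟩ := exists_norm_convLayer_sub_le hσ (hk i) (N.bias i) (N.skip i)
      (N.filter i)
    -- Each of the `k i` activations read by the layer is bounded by `c` times the full sum over the
    -- enlarged lookahead.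
    refine ⟨d * (k i * c), by positivity, fun x y t => ?_⟩
    rw [hidden_succ, hidden_succ]
    refine (hconv _ _ t).trans ?_
    rw [mul_assoc, mul_assoc]
    refine mul_le_mul_of_nonneg_left ?_ hd
    have h1 : ∀ j ∈ Finset.range (k i),
        ‖N.hidden σ x i.castSucc (t + j) - N.hidden σ y i.castSucc (t + j)‖ ≤
          c * ∑ s ∈ Finset.range (lookahead k i.succ + 1), ‖x (t + s) - y (t + s)‖ := by
      intro j hj
      have hj := Finset.mem_range.1 hj
      refine (ih x y (t + j)).trans (mul_le_mul_of_nonneg_left ?_ hc)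
      have h2 : ∑ s ∈ Finset.range (lookahead k i.castSucc + 1), ‖x (t + j + s) - y (t + j + s)‖ =
          ∑ s ∈ (Finset.range (lookahead k i.castSucc + 1)).map (addLeftEmbedding j),
            ‖x (t + s) - y (t + s)‖ := by
        simp [add_assoc]
      rw [h2]
      refine Finset.sum_le_sum_of_subset_of_nonneg ?_ fun _ _ _ => norm_nonneg _
      intro s hs
      simp only [Finset.mem_map, Finset.mem_range, addLeftEmbedding_apply] at hs ⊢
      obtain ⟨u, hu, rfl⟩ := hs
      rw [lookahead_succ]
      omega
    refine (Finset.sum_le_sum h1).trans_eq ?_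
    rw [Finset.sum_const, Finset.card_range, nsmul_eq_mul]

lemma hidden_shift (N : ResFCN L m k) (σ : ℝ → ℝ) (x : ℕ → Vec (m 0)) (r : ℕ) (ℓ : Fin (L + 1)) :
    ∀ t, N.hidden σ (fun s => x (s + r)) ℓ t = N.hidden σ x ℓ (t + r) := by
  induction ℓ using Fin.induction with
  | zero => exact fun t => rfl
  | succ i ih =>
    intro t
    rw [hidden_succ, hidden_succ]
    simp only [convLayer, ih]
    simp only [add_right_comm]

lemma zeroPad_one_add {d n : ℕ} (u : Fin n → Vec d) (i : Fin n) :
    zeroPad u (1 + (i : ℕ)) = u i := by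
  have h : 1 ≤ 1 + (i : ℕ) ∧ 1 + (i : ℕ) ≤ n := by omega
  rw [zeroPad, dif_pos h]
  congr 1
  ext
  simp

/-- The last activations on an arbitrary sequence are given by the window map. -/
lemma hidden_last_eq_windowMap (N : ResFCN L m k) {σ : ℝ → ℝ} {C : ℝ≥0} (hσ : LipschitzWith C σ)
    (hk : ∀ i, 1 ≤ k i) (x : ℕ → Vec (m 0)) {t : ℕ} (ht : 1 ≤ t) :
    N.hidden σ x (Fin.last L) t = N.windowMap σ (window (windowLength k) x t) := by
  obtain ⟨c, hc, h⟩ := N.exists_norm_hidden_sub_le hσ hk (Fin.last L)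
  rw [windowMap, output]
  have h1 := N.hidden_shift σ x (t - 1) (Fin.last L) 1
  rw [show 1 + (t - 1) = t by omega] at h1
  -- The Lipschitz bound also encodes locality: the shifted sequence and the padded window agree at
  -- every time entering it, so the outputs coincide.
  rw [← h1, ← sub_eq_zero, ← norm_le_zero_iff]
  refine (h _ _ 1).trans_eq ?_
  rw [← windowLength_eq hk, ← Fin.sum_univ_eq_sum_range
    fun s => ‖x (1 + s + (t - 1)) - zeroPad (window (windowLength k) x t) (1 + s)‖]
  rw [Finset.sum_eq_zero, mul_zero]
  intro i _
  rw [zeroPad_one_add, window, show 1 + (i : ℕ) + (t - 1) = t + i by omega, sub_self, norm_zero]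

lemma exists_lipschitzWith_windowMap (N : ResFCN L m k) {σ : ℝ → ℝ} {C : ℝ≥0}
    (hσ : LipschitzWith C σ) (hk : ∀ i, 1 ≤ k i) : ∃ c : ℝ≥0, LipschitzWith c (N.windowMap σ) := by
  obtain ⟨c, hc, h⟩ := N.exists_norm_hidden_sub_le hσ hk (Fin.last L)
  refine ⟨⟨c * windowLength k, by positivity⟩, LipschitzWith.of_dist_le_mul fun u v => ?_⟩
  rw [dist_eq_norm]
  refine (h (zeroPad u) (zeroPad v) 1).trans ?_
  rw [← windowLength_eq hk, ← Fin.sum_univ_eq_sum_range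
    fun s => ‖zeroPad u (1 + s) - zeroPad v (1 + s)‖]
  simp only [zeroPad_one_add]
  change _ ≤ c * (windowLength k : ℝ) * dist u v
  rw [mul_assoc]
  refine mul_le_mul_of_nonneg_left ?_ hc
  calc ∑ i, ‖u i - v i‖ ≤ ∑ _i : Fin (windowLength k), dist u v :=
        Finset.sum_le_sum fun i _ => by
          rw [← dist_eq_norm]
          exact dist_le_pi_dist u v i
    _ = windowLength k * dist u v := by simp

end ResFCN

end FCN

/-! ### Limit theorem for a linear process, with zero padding -/

namespace ProbabilityTheory

variable {Ω : Type*} {mΩ : MeasurableSpace Ω} {μ : Measure Ω} [IsProbabilityMeasure μ]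

lemma sqrt_variance_sum_le {ι : Type*} (s : Finset ι) {U : ι → Ω → ℝ}
    (hU : ∀ i ∈ s, MemLp (U i) 2 μ) :
    √(Var[fun ω => ∑ i ∈ s, U i ω; μ]) ≤ ∑ i ∈ s, √(Var[U i; μ]) := by
  classical
  induction s using Finset.induction_on with
  | empty =>
    simp only [Finset.sum_empty]
    rw [show Var[fun _ : Ω => (0 : ℝ); μ] = 0 from variance_zero μ, Real.sqrt_zero]
  | insert i s hi ih =>
    simp only [Finset.sum_insert hi]
    refine (sqrt_variance_add_le (hU i (Finset.mem_insert_self _ _))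
      (memLp_finsetSum s fun j hj => hU j (Finset.mem_insert_of_mem hj))).trans ?_
    gcongr
    exact ih fun j hj => hU j (Finset.mem_insert_of_mem hj)

variable {E : Type*} [NormedAddCommGroup E] [NormedSpace ℝ E] [MeasurableSpace E] [BorelSpace E]
  [SecondCountableTopology E] {K : ℕ} {a : ℤ → E →L[ℝ] E} {Z : ℤ → Ω → E} {X : ℕ → Ω → E}

namespace IsLinearSeries

lemma covariance_window_add (hX : IsLinearSeries μ a Z X) (hZ : IsIIDNoise μ Z)
    (ha : Summable fun j => ‖a j‖) {f : (Fin K → E) → ℝ} {C : ℝ≥0} (hf : LipschitzWith C f)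
    (t h : ℕ) :
    cov[fun ω => f fun κ => X (t + κ) ω, fun ω => f fun κ => X (t + h + κ) ω; μ] =
      cov[fun ω => f fun κ => X (0 + κ) ω, fun ω => f fun κ => X (h + κ) ω; μ] := by
  have h1 := hX.covariance_window_shift hZ ha hf hf 0 h t
  rwa [zero_add, add_comm h t] at h1

/-- The variances of the partial sums of a Lipschitz observable of a linear process grow at the
rate given by the long-run variance. -/
lemma tendsto_variance_window_sum (hX : IsLinearSeries μ a Z X) (hZ : IsIIDNoise μ Z)
    (ha : Summable fun j => ‖a j‖) {f : (Fin K → E) → ℝ} {C : ℝ≥0} (hf : LipschitzWith C f) :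
    Tendsto (fun n : ℕ => (n : ℝ)⁻¹ *
      Var[fun ω => ∑ t ∈ Finset.range n, f fun κ => X (t + κ) ω; μ]) atTop
      (nhds (cov[fun ω => f fun κ => X (0 + κ) ω, fun ω => f fun κ => X (0 + κ) ω; μ] +
        ∑' h : ℕ, 2 * cov[fun ω => f fun κ => X (0 + κ) ω,
          fun ω => f fun κ => X (h + 1 + κ) ω; μ])) :=
  tendsto_variance_sum_div (Y := fun t ω => f fun κ => X (t + κ) ω)
    (hX.memLp_window hZ ha hf) (fun t h => hX.covariance_window_add hZ ha hf t h)
    (hX.summable_covariance_window hZ ha hf hf)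

/-- The central limit theorem for partial sums of a Lipschitz observable of a linear process. -/
theorem tendsto_centeredChar_window_sum (hX : IsLinearSeries μ a Z X) (hZ : IsIIDNoise μ Z)
    (ha : Summable fun j => ‖a j‖) (ha0 : ∀ j < 0, a j = 0) {f : (Fin K → E) → ℝ} {C : ℝ≥0}
    (hf : LipschitzWith C f) :
    Tendsto (fun n : ℕ => centeredChar μ fun ω =>
      (√n)⁻¹ * ∑ t ∈ Finset.range n, f fun κ => X (t + κ) ω) atTop
      (nhds (Complex.exp (-((cov[fun ω => f fun κ => X (0 + κ) ω,
        fun ω => f fun κ => X (0 + κ) ω; μ] + ∑' h : ℕ, 2 * cov[fun ω => f fun κ => X (0 + κ) ω,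
          fun ω => f fun κ => X (h + 1 + κ) ω; μ] : ℝ) : ℂ) / 2))) := by
  obtain ⟨ε, r, hε, h⟩ := hX.exists_variance_sub_blockSum_le hZ ha ha0 hf
  exact tendsto_centeredChar_of_blocks
    (fun n => memLp_finsetSum _ fun t _ => hX.memLp_window hZ ha hf t)
    (B := fun p => blockSum a Z f p) (fun p => hZ.memLp_blockSum hf p 0)
    (fun p => hZ.iIndepFun_blockSum hf p) (fun p i => hZ.identDistrib_blockSum hf p i)
    (hX.tendsto_variance_window_sum hZ ha hf) hε h

/-- The entries of a window that starts at time `t`, with times `≥ n` replaced by zero. -/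
noncomputable def paddedWindow (K : ℕ) (X : ℕ → Ω → E) (n t : ℕ) (ω : Ω) : Fin K → E :=
  fun κ => if t + κ < n then X (t + κ) ω else 0

lemma memLp_paddedWindow (hX : IsLinearSeries μ a Z X) (hZ : IsIIDNoise μ Z)
    (ha : Summable fun j => ‖a j‖) (n t : ℕ) (κ : Fin K) :
    MemLp (fun ω => paddedWindow K X n t ω κ) 2 μ := by
  simp only [paddedWindow]
  split_ifs
  · exact hX.memLp hZ ha _
  · exact memLp_const 0

/-- Replacing the inputs after time `n` by zero changes the sum over the windows that start before
time `n` by a bounded amount. -/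
lemma exists_variance_padded_sub_le (hX : IsLinearSeries μ a Z X) (hZ : IsIIDNoise μ Z)
    (ha : Summable fun j => ‖a j‖) {f : (Fin K → E) → ℝ} {C : ℝ≥0} (hf : LipschitzWith C f) :
    ∃ c : ℝ, ∀ n, Var[fun ω => (∑ t ∈ Finset.range n, f (paddedWindow K X n t ω)) -
      ∑ t ∈ Finset.range n, f fun κ => X (t + κ) ω; μ] ≤ c := by
  set z : ℝ := (∑' j, ‖a j‖) * (eLpNorm (Z 0) 2 μ).toReal with hzdef
  have hz : 0 ≤ z := mul_nonneg (tsum_nonneg fun _ => norm_nonneg _) ENNReal.toReal_nonneg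
  have hXz : ∀ t, eLpNorm (X t) 2 μ ≤ ENNReal.ofReal z := fun t => by
    have h := hZ.eLpNorm_sub_maskedSeries_le ha (hX t) ∅
    simp only [maskedSeries, Finset.sum_empty, sub_zero] at h
    refine h.trans (ENNReal.ofReal_le_ofReal ?_)
    rw [hzdef]
    gcongr
    exact maskTail_le ha _ _
  set w : ℝ := C * ∑ _κ : Fin K, z
  have hw : 0 ≤ w := by positivity
  -- At most `K` windows reach past the end of the input, each with an error of standard deviation
  -- at most `w`.
  refine ⟨(K * w) ^ 2, fun n => ?_⟩
  set D : ℕ → Ω → ℝ := fun t ω => f (paddedWindow K X n t ω) - f fun κ => X (t + κ) ω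
  have hD : ∀ t, MemLp (D t) 2 μ := fun t =>
    (hf.memLp_comp_pi (hX.memLp_paddedWindow hZ ha n t)).sub (hX.memLp_window hZ ha hf t)
  have hDw : ∀ t, √(Var[D t; μ]) ≤ w := fun t =>
    hf.sqrt_variance_comp_sub_le (X := fun κ ω => paddedWindow K X n t ω κ)
      (X' := fun κ => X (t + κ)) (hX.memLp_paddedWindow hZ ha n t) (fun κ => hX.memLp hZ ha _)
      (r := fun _ => z) (fun _ => hz) fun κ => by
        simp only [paddedWindow]
        split_ifs
        · simp
        · simp only [zero_sub]
          exact (eLpNorm_neg (X (t + κ)) 2 μ).trans_le (hXz _)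
  have hD0 : ∀ t, t + K ≤ n → √(Var[D t; μ]) = 0 := fun t ht => by
    have h0 : D t = fun _ => 0 := by
      ext ω
      have h1 : paddedWindow K X n t ω = fun κ : Fin K => X (t + κ) ω := by
        ext κ
        simp only [paddedWindow]
        rw [if_pos (by omega)]
      simp only [D, h1, sub_self]
    rw [h0, show Var[fun _ : Ω => (0 : ℝ); μ] = 0 from variance_zero μ, Real.sqrt_zero]
  refine (Real.sqrt_le_iff.1 ?_).2
  simp only [← Finset.sum_sub_distrib]
  refine (sqrt_variance_sum_le (U := D) _ fun t _ => hD t).trans ?_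
  have h1 : ∀ t ∈ Finset.range n, √(Var[D t; μ]) ≤ if n < t + K then w else 0 := fun t _ => by
    split_ifs with ht
    · exact hDw t
    · exact (hD0 t (by omega)).le
  refine (Finset.sum_le_sum h1).trans ?_
  rw [← Finset.sum_filter, Finset.sum_const, nsmul_eq_mul]
  gcongr
  have h2 : (Finset.range n).filter (fun t => n < t + K) ⊆ Finset.Ico (n - K) n := by
    intro t ht
    simp only [Finset.mem_filter, Finset.mem_range, Finset.mem_Ico] at ht ⊢
    omega
  refine (Finset.card_le_card h2).trans ?_
  simp
  omega

/-- The central limit theorem for the zero-padded sums of a Lipschitz observable of a linear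
process. -/
theorem tendsto_centeredChar_padded_sum (hX : IsLinearSeries μ a Z X) (hZ : IsIIDNoise μ Z)
    (ha : Summable fun j => ‖a j‖) (ha0 : ∀ j < 0, a j = 0) {f : (Fin K → E) → ℝ} {C : ℝ≥0}
    (hf : LipschitzWith C f) :
    Tendsto (fun n : ℕ => centeredChar μ fun ω =>
      (√n)⁻¹ * ∑ t ∈ Finset.range n, f (paddedWindow K X n t ω)) atTop
      (nhds (Complex.exp (-((cov[fun ω => f fun κ => X (0 + κ) ω,
        fun ω => f fun κ => X (0 + κ) ω; μ] + ∑' h : ℕ, 2 * cov[fun ω => f fun κ => X (0 + κ) ω,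
          fun ω => f fun κ => X (h + 1 + κ) ω; μ] : ℝ) : ℂ) / 2))) := by
  obtain ⟨c, hc⟩ := hX.exists_variance_padded_sub_le hZ ha hf
  exact tendsto_centeredChar_of_variance_sub_le
    (fun n => memLp_finsetSum _ fun t _ => hX.memLp_window hZ ha hf t)
    (fun n => memLp_finsetSum _ fun t _ => hf.memLp_comp_pi (hX.memLp_paddedWindow hZ ha n t))
    hc (hX.tendsto_centeredChar_window_sum hZ ha ha0 hf)

end IsLinearSeries

end ProbabilityTheory

/-! ### Translation to the network and to matrices -/

namespace FCN

variable {Ω : Type*} [MeasurableSpace Ω] {μ : Measure Ω}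

section LinearProcess

variable {d : ℕ} {A : ℕ → Matrix (Fin d) (Fin d) ℝ} {Z : ℤ → Ω → Vec d} {X : ℕ → Ω → Vec d}

/-- The coefficients of a causal linear process, extended by zero to negative lags. -/
noncomputable def lagCoeff (A : ℕ → Matrix (Fin d) (Fin d) ℝ) : ℤ → Vec d →L[ℝ] Vec d :=
  Function.extend (fun j : ℕ => (j : ℤ)) (fun j => Matrix.toEuclideanCLM (𝕜 := ℝ) (n := Fin d) (A j))
    0

lemma lagCoeff_natCast (j : ℕ) :
    lagCoeff A j = Matrix.toEuclideanCLM (𝕜 := ℝ) (n := Fin d) (A j) :=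
  Nat.cast_injective.extend_apply _ _ _

lemma lagCoeff_of_notMem {j : ℤ} (hj : j ∉ Set.range fun j : ℕ => (j : ℤ)) : lagCoeff A j = 0 :=
  Function.extend_apply' _ _ _ hj

lemma lagCoeff_of_neg {j : ℤ} (hj : j < 0) : lagCoeff A j = 0 :=
  lagCoeff_of_notMem (by
    rintro ⟨i, rfl⟩
    simp only at hj
    omega)

namespace IsLinearProcess

lemma summable_lagCoeff (hX : IsLinearProcess μ A Z X) : Summable fun j => ‖lagCoeff A j‖ := by
  have hinj : Function.Injective fun j : ℕ => (j : ℤ) := Nat.cast_injective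
  refine (hinj.summable_iff fun j hj => by rw [lagCoeff_of_notMem hj, norm_zero]).1 ?_
  refine hX.summable.congr fun j => ?_
  simp only [Function.comp_apply, lagCoeff_natCast]

/-- The general results start at time 0 and the process at time 1; moving the noise together with
the series leaves the lags unchanged. -/
lemma isIIDNoise (hX : IsLinearProcess μ A Z X) : IsIIDNoise μ fun s => Z (s + 1) :=
  IsIIDNoise.shift ⟨hX.measurable, hX.indep, hX.identDistrib, hX.memLp⟩ 1

lemma isLinearSeries (hX : IsLinearProcess μ A Z X) :
    IsLinearSeries μ (lagCoeff A) (fun s => Z (s + 1)) fun t => X (t + 1) := by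
  intro t
  filter_upwards [hX.eq_sum (t + 1) (by omega)] with ω hω
  have hinj : Function.Injective fun j : ℕ => (j : ℤ) := Nat.cast_injective
  rw [← (Equiv.subLeft (t : ℤ)).hasSum_iff, ← hinj.hasSum_iff]
  · refine hω.congr_fun fun j => ?_
    simp only [Function.comp_apply, Equiv.subLeft_apply, sub_sub_cancel, lagCoeff_natCast]
    congr 2
    push_cast
    ring
  · intro j hj
    simp only [Function.comp_apply, Equiv.subLeft_apply, sub_sub_cancel, lagCoeff_of_notMem hj,
      zero_apply]

end IsLinearProcess

end LinearProcess

section Covariance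

variable {q : ℕ} {Y : ℕ → Ω → Vec q}

lemma covariance_sum_mul_eq_lagCov [IsProbabilityMeasure μ]
    (hY : ∀ t ≥ 1, ∀ j, MemLp (fun ω => Y t ω j) 2 μ)
    (h : ℕ) (θ : Fin q → ℝ) :
    cov[fun ω => ∑ j, θ j * Y 1 ω j, fun ω => ∑ j, θ j * Y (1 + h) ω j; μ] =
      θ ⬝ᵥ lagCov μ Y h *ᵥ θ := by
  rw [covariance_fun_sum_fun_sum (fun j => (hY 1 le_rfl j).const_mul (θ j))
    fun j => (hY (1 + h) (by omega) j).const_mul (θ j)]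
  simp only [covariance_const_mul_left, covariance_const_mul_right, dotProduct, Matrix.mulVec,
    lagCov, Matrix.of_apply, Finset.mul_sum]
  refine Finset.sum_congr rfl fun j _ => Finset.sum_congr rfl fun l _ => ?_
  ring

lemma longRunCov_isHermitian : (longRunCov μ Y).IsHermitian := by
  ext j l
  simp only [Matrix.conjTranspose_apply, longRunCov, Matrix.of_apply, star_trivial]
  congr 1
  · simp only [lagCov, Matrix.of_apply, add_zero]
    exact covariance_comm _ _
  · exact tsum_congr fun h => add_comm _ _

/-- A matrix and its transpose have the same quadratic form, which produces the 2; entrywise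
summability lets the finite sums pass through the series. -/
lemma dotProduct_longRunCov_mulVec
    (hs : ∀ j l, Summable fun h : ℕ => lagCov μ Y (h + 1) j l) (θ : Fin q → ℝ) :
    θ ⬝ᵥ longRunCov μ Y *ᵥ θ =
      θ ⬝ᵥ lagCov μ Y 0 *ᵥ θ + ∑' h : ℕ, 2 * (θ ⬝ᵥ lagCov μ Y (h + 1) *ᵥ θ) := by
  have hquad : ∀ M : Matrix (Fin q) (Fin q) ℝ, θ ⬝ᵥ M *ᵥ θ = ∑ j, ∑ l, θ j * θ l * M j l := by
    intro M
    simp only [dotProduct, Matrix.mulVec, Finset.mul_sum]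
    refine Finset.sum_congr rfl fun j _ => Finset.sum_congr rfl fun l _ => ?_
    ring
  have hsum : ∀ j l, Summable fun h : ℕ =>
      θ j * θ l * (lagCov μ Y (h + 1) j l + lagCov μ Y (h + 1) l j) := fun j l =>
    ((hs j l).add (hs l j)).mul_left _
  have h2 : ∀ h : ℕ, 2 * (θ ⬝ᵥ lagCov μ Y (h + 1) *ᵥ θ) =
      ∑ j, ∑ l, θ j * θ l * (lagCov μ Y (h + 1) j l + lagCov μ Y (h + 1) l j) := by
    intro h
    simp only [mul_add, Finset.sum_add_distrib]
    rw [hquad, two_mul]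
    congr 1
    rw [Finset.sum_comm]
    refine Finset.sum_congr rfl fun j _ => Finset.sum_congr rfl fun l _ => ?_
    ring
  simp only [h2]
  rw [Summable.tsum_finsetSum fun j _ => summable_sum fun l _ => hsum j l, hquad, hquad,
    ← Finset.sum_add_distrib]
  refine Finset.sum_congr rfl fun j _ => ?_
  rw [Summable.tsum_finsetSum fun l _ => hsum j l, ← Finset.sum_add_distrib]
  refine Finset.sum_congr rfl fun l _ => ?_
  rw [tsum_mul_left, ← mul_add]
  rfl

end Covariance

/-- Linear combinations of the coordinates of a Lipschitz map are Lipschitz. -/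
lemma exists_lipschitzWith_sum_mul {α : Type*} [PseudoEMetricSpace α] {q : ℕ} {g : α → Vec q}
    {C : ℝ≥0} (hg : LipschitzWith C g) (θ : Fin q → ℝ) :
    ∃ D : ℝ≥0, LipschitzWith D fun u => ∑ j, θ j * g u j := by
  have h := (innerSL ℝ (WithLp.toLp 2 θ)).lipschitz.comp hg
  refine ⟨‖innerSL ℝ (WithLp.toLp 2 θ)‖₊ * C, ?_⟩
  have he : (fun u => ∑ j, θ j * g u j) = innerSL ℝ (WithLp.toLp 2 θ) ∘ g := by
    ext u
    simp [PiLp.inner_apply, mul_comm]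
  rw [he]
  exact h

lemma _root_.LipschitzWith.memLp_comp_pi_vec [IsProbabilityMeasure μ] {d q K : ℕ}
    {g : (Fin K → Vec d) → Vec q} {C : ℝ≥0} (hg : LipschitzWith C g) {X : Fin K → Ω → Vec d}
    (hX : ∀ i, MemLp (X i) 2 μ) : MemLp (fun ω => g fun i => X i ω) 2 μ := by
  have h1 : AEMeasurable (fun ω i => X i ω) μ :=
    aemeasurable_pi_lambda _ fun i => (hX i).aestronglyMeasurable.aemeasurable
  have h2 : AEStronglyMeasurable (fun ω => g fun i => X i ω) μ :=
    (hg.continuous.measurable.comp_aemeasurable h1).aestronglyMeasurable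
  refine (memLp_norm_iff h2).1 ?_
  exact (lipschitzWith_one_norm.comp hg).memLp_comp_pi hX

namespace ResFCN

variable {L : ℕ} {m : Fin (L + 1) → ℕ} {k : Fin L → ℕ}

omit [MeasurableSpace Ω] in
lemma window_zeroPad_eq_paddedWindow {d : ℕ} (X : ℕ → Ω → Vec d) (K n t : ℕ) (ω : Ω) :
    window K (zeroPad fun i : Fin n => X (i + 1) ω) (t + 1) =
      IsLinearSeries.paddedWindow K (fun t => X (t + 1)) n t ω := by
  ext κ : 1
  simp only [window, zeroPad, IsLinearSeries.paddedWindow]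
  by_cases h : t + κ < n
  · rw [if_pos h, dif_pos (by omega)]
    congr 1
    simp
  · rw [if_neg h, dif_neg (by omega)]

omit [MeasurableSpace Ω] in
lemma gap_eq_sum_paddedWindow (N : ResFCN L m k) {σ : ℝ → ℝ} {C : ℝ≥0} (hσ : LipschitzWith C σ)
    (hk : ∀ i, 1 ≤ k i) (X : ℕ → Ω → Vec (m 0)) (n : ℕ) (ω : Ω) :
    (N.gap σ fun i : Fin n => X (i + 1) ω) = (n : ℝ)⁻¹ • ∑ t ∈ Finset.range n,
      N.windowMap σ (IsLinearSeries.paddedWindow _ (fun t => X (t + 1)) n t ω) := by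
  have h : Finset.Icc 1 n = Finset.Ico 1 (n + 1) := by
    ext
    simp only [Finset.mem_Icc, Finset.mem_Ico]
    omega
  rw [gap, h, Finset.sum_Ico_eq_sum_range]
  congr 1
  refine Finset.sum_congr (by simp) fun t _ => ?_
  rw [output, N.hidden_last_eq_windowMap hσ hk _ (by omega), add_comm 1 t,
    window_zeroPad_eq_paddedWindow]

end ResFCN

end FCN

theorem theorem3 {Ω : Type*} [MeasurableSpace Ω] (μ : Measure Ω) [IsProbabilityMeasure μ]
    {L : ℕ} {m : Fin (L + 1) → ℕ} {k : Fin L → ℕ} (hk : ∀ i, 1 ≤ k i)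
    (N : FCN.ResFCN L m k) (σ : ℝ → ℝ) (hσ : ∃ C : ℝ≥0, LipschitzWith C σ)
    (A : ℕ → Matrix (Fin (m 0)) (Fin (m 0)) ℝ) (Z : ℤ → Ω → FCN.Vec (m 0))
    (X : ℕ → Ω → FCN.Vec (m 0)) (hX : FCN.IsLinearProcess μ A Z X) :
    -- the window map is Lipschitz and represents the network
    (∃ C : ℝ≥0, LipschitzWith C (N.windowMap σ)) ∧
    (∀ (n : ℕ) (x : Fin n → FCN.Vec (m 0)) (t : ℕ), 1 ≤ t →
      N.output σ x t = N.windowMap σ (FCN.window _ (FCN.zeroPad x) t)) ∧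
    -- all moments below exist
    (∀ n : ℕ, Integrable (fun ω => N.gap σ fun i : Fin n => X (i + 1) ω) μ) ∧
    (∀ t : ℕ, 1 ≤ t →
      MemLp (fun ω => N.windowMap σ (FCN.window _ (fun s => X s ω) t)) 2 μ) ∧
    -- the long-run covariance series converge absolutely and give a covariance matrix
    (∀ j l, Summable fun h : ℕ =>
      FCN.lagCov μ (fun t ω => N.windowMap σ (FCN.window _ (fun s => X s ω) t)) (h + 1) j l) ∧
    (FCN.longRunCov μ
      (fun t ω => N.windowMap σ (FCN.window _ (fun s => X s ω) t))).PosSemidef ∧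
    -- the central limit theorem
    TendstoInDistribution
      (fun (n : ℕ) ω => √(n : ℝ) •
        ((N.gap σ fun i : Fin n => X (i + 1) ω) -
          ∫ ω', (N.gap σ fun i : Fin n => X (i + 1) ω') ∂μ))
      atTop id (fun _ => μ)
      (multivariateGaussian 0 (FCN.longRunCov μ
        (fun t ω => N.windowMap σ (FCN.window _ (fun s => X s ω) t)))) := by
  obtain ⟨C, hσ⟩ := hσ
  obtain ⟨c, hg⟩ := N.exists_lipschitzWith_windowMap hσ hk
  set Y : ℕ → Ω → FCN.Vec (m (Fin.last L)) :=
    fun t ω => N.windowMap σ (FCN.window _ (fun s => X s ω) t) with hYdef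
  have hZ := hX.isIIDNoise
  have ha := hX.summable_lagCoeff
  have hS := hX.isLinearSeries
  have hYX : ∀ t ω, Y (t + 1) ω = N.windowMap σ fun κ => X (t + κ + 1) ω := fun t ω => by
    simp only [hYdef]
    congr 1
    ext κ : 1
    simp only [FCN.window, add_right_comm]
  have hYmem : ∀ t : ℕ, 1 ≤ t → MemLp (Y t) 2 μ := fun t ht => by
    obtain ⟨t, rfl⟩ := Nat.exists_eq_add_of_le' ht
    rw [show Y (t + 1) = _ from funext (hYX t)]
    exact hg.memLp_comp_pi_vec fun κ => hS.memLp hZ ha (t + κ)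
  have hcoord : ∀ t ≥ 1, ∀ j, MemLp (fun ω => Y t ω j) 2 μ := fun t ht j =>
    (EuclideanSpace.proj (𝕜 := ℝ) j).comp_memLp' (hYmem t ht)
  have hgap : ∀ n : ℕ, MemLp (fun ω => N.gap σ fun i : Fin n => X (i + 1) ω) 2 μ := fun n => by
    simp only [N.gap_eq_sum_paddedWindow hσ hk X]
    exact (memLp_finsetSum (Finset.range n) fun t _ =>
      hg.memLp_comp_pi_vec (hS.memLp_paddedWindow hZ ha n t)).const_smul (n : ℝ)⁻¹
  have hsummable : ∀ j l, Summable fun h : ℕ => FCN.lagCov μ Y (h + 1) j l := fun j l => by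
    have hj := (EuclideanSpace.proj (𝕜 := ℝ) j).lipschitz.comp hg
    have hl := (EuclideanSpace.proj (𝕜 := ℝ) l).lipschitz.comp hg
    refine (hS.summable_covariance_window hZ ha hj hl).congr fun h => ?_
    have h1 := hYX 0
    have h2 := hYX (h + 1)
    rw [zero_add] at h1
    rw [add_comm (h + 1) 1] at h2
    simp only [FCN.lagCov, Matrix.of_apply, h1, h2]
    rfl
  have hcov : ∀ (θ : Fin (m (Fin.last L)) → ℝ) (h : ℕ),
      cov[fun ω => ∑ j, θ j * (N.windowMap σ fun κ => X (0 + κ + 1) ω) j,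
        fun ω => ∑ j, θ j * (N.windowMap σ fun κ => X (h + κ + 1) ω) j; μ] =
      θ ⬝ᵥ FCN.lagCov μ Y h *ᵥ θ := fun θ h => by
    have h1 := hYX 0
    have h2 := hYX h
    rw [zero_add] at h1
    rw [add_comm h 1] at h2
    rw [← FCN.covariance_sum_mul_eq_lagCov hcoord h θ]
    simp only [h1, h2]
  have hquad : ∀ θ : Fin (m (Fin.last L)) → ℝ,
      cov[fun ω => ∑ j, θ j * (N.windowMap σ fun κ => X (0 + κ + 1) ω) j,
        fun ω => ∑ j, θ j * (N.windowMap σ fun κ => X (0 + κ + 1) ω) j; μ] +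
        ∑' h : ℕ, 2 * cov[fun ω => ∑ j, θ j * (N.windowMap σ fun κ => X (0 + κ + 1) ω) j,
          fun ω => ∑ j, θ j * (N.windowMap σ fun κ => X (h + 1 + κ + 1) ω) j; μ] =
      θ ⬝ᵥ FCN.longRunCov μ Y *ᵥ θ := fun θ => by
    rw [FCN.dotProduct_longRunCov_mulVec hsummable, hcov]
    simp only [hcov]
  have hpos : (FCN.longRunCov μ Y).PosSemidef := by
    refine .of_dotProduct_mulVec_nonneg FCN.longRunCov_isHermitian fun θ => ?_
    obtain ⟨D, hD⟩ := FCN.exists_lipschitzWith_sum_mul hg θ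
    rw [star_trivial, ← hquad θ]
    -- The quadratic form at `θ` is a limit of nonnegative normalized variances.
    refine ge_of_tendsto (hS.tendsto_variance_window_sum hZ ha hD)
      (Eventually.of_forall fun n => ?_)
    exact mul_nonneg (by positivity) (variance_nonneg _ _)
  refine ⟨⟨c, hg⟩, fun n x t ht => N.hidden_last_eq_windowMap hσ hk _ ht,
    fun n => (hgap n).integrable (by norm_num), hYmem, hsummable, hpos, ?_⟩
  have hmeas : ∀ n : ℕ, AEMeasurable (fun ω => √(n : ℝ) •
      ((N.gap σ fun i : Fin n => X (i + 1) ω) -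
        ∫ ω', (N.gap σ fun i : Fin n => X (i + 1) ω') ∂μ)) μ := fun n => by
    have h := (hgap n).aestronglyMeasurable.aemeasurable
    exact (h.sub_const (∫ ω', (N.gap σ fun i : Fin n => X (i + 1) ω') ∂μ)).const_smul √(n : ℝ)
  -- The characteristic function at `θ` is `centeredChar` of the normalized padded sum of the scalar
  -- observable given by pairing the window map with `θ`.
  refine ⟨hmeas, aemeasurable_id, ProbabilityMeasure.tendsto_iff_tendsto_charFun.2 fun θ => ?_⟩
  obtain ⟨D, hD⟩ := FCN.exists_lipschitzWith_sum_mul hg θ.ofLp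
  have hlim := hS.tendsto_centeredChar_padded_sum hZ ha (fun j hj => FCN.lagCoeff_of_neg hj) hD
  rw [hquad θ.ofLp] at hlim
  simp only [ProbabilityMeasure.coe_mk, Measure.map_id, charFun_multivariateGaussian hpos,
    inner_zero_right, Complex.ofReal_zero, zero_mul, zero_sub]
  rw [← neg_div]
  refine hlim.congr fun n => ?_
  rw [charFun_apply, integral_map (hmeas n) (by fun_prop), centeredChar]
  have hinner : ∀ ω, inner ℝ (N.gap σ fun i : Fin n => X (i + 1) ω) θ =
      (n : ℝ)⁻¹ * ∑ t ∈ Finset.range n, ∑ j, θ j *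
        (N.windowMap σ (IsLinearSeries.paddedWindow _ (fun t => X (t + 1)) n t ω)) j := by
    intro ω
    rw [N.gap_eq_sum_paddedWindow hσ hk X, real_inner_smul_left, sum_inner]
    congr 1
  have hmean : inner ℝ (∫ ω', (N.gap σ fun i : Fin n => X (i + 1) ω') ∂μ) θ =
      ∫ ω', inner ℝ (N.gap σ fun i : Fin n => X (i + 1) ω') θ ∂μ := by
    simp only [fun ω => real_inner_comm θ (N.gap σ fun i : Fin n => X (i + 1) ω)]
    rw [integral_inner ((hgap n).integrable (by norm_num)), real_inner_comm]
  -- Also true at `n = 0`, where both sides are 0.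
  have hn : (√(n : ℝ))⁻¹ = √n * (n : ℝ)⁻¹ := by
    rw [← div_eq_mul_inv, Real.sqrt_div_self]
  congr 1 with ω
  rw [real_inner_smul_left, inner_sub_left, hmean, mul_comm Complex.I]
  simp only [hinner, hn, mul_assoc, integral_const_mul]
  congr 3
  ring
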